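/- Let $k_0,k_1,u_0,u_1\in\mathbb C^\star$ and $\hbar\in\mathbb C$, put $q^{t}=e^{-i\pi\hbar t}$, so that $q=e^{-i\pi\hbar}$, and assume $q^m\ne 1$ for all integers $m>0$. Let $\mathcal H$ (the Cherednik algebra of type $\check C_1C_1$) be the unital associative $\mathbb C$-algebra generated by $V_0,V_1,\check V_0,\check V_1$ with the relations $$(V_0-k_0)(V_0+k_0^{-1})=0,\quad (V_1-k_1)(V_1+k_1^{-1})=0,\quad (\check V_0-u_0)(\check V_0+u_0^{-1})=0,\quad (\check V_1-u_1)(\check V_1+u_1^{-1})=0,$$ $$\check V_1V_1V_0\check V_0=q^{-1/2}.$$ Let $\mathbb T_q$ be the quantum torus generated by $e^{\pm S_1},e^{\pm S_2},e^{\pm S_3}$, where $[S_1,S_2]=[S_2,S_3]=[S_3,S_1]=i\pi\hbar$ (so that $e^Ae^B=e^{[A,B]/2}e^{A+B}$ for integer combinations $A,B$ of $S_1,S_2,S_3$) and the central element $e^{-S_1-S_2-S_3}$ is the scalar fixed by $u_0=-i\,e^{-S_1-S_2-S_3}$; it has the $\mathbb C$-basis $e^{aS_1+bS_2}$, $a,b\in\mathbb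 Z$. Write $\overline k=k-k^{-1}$ for $k\in\mathbb C^\star$, and $$s=-\overline k_0e^{-S_1-S_2}-\overline k_1e^{-S_1+S_3}-\overline u_1e^{S_2+S_3}+i\,e^{-S_1-S_2+S_3}+i\,e^{-S_1+S_2+S_3}-u_0 .$$ Then the assignment $$V_0\mapsto\begin{pmatrix}k_0-k_0^{-1}-i e^{-S_3}&-i e^{-S_3}\\ k_0^{-1}-k_0+i e^{-S_3}+i e^{S_3}&i e^{-S_3}\end{pmatrix},\qquad V_1\mapsto\begin{pmatrix}k_1-k_1^{-1}-i e^{S_2}&k_1-k_1^{-1}-i e^{-S_2}-i e^{S_2}\\ i e^{S_2}&i e^{S_2}\end{pmatrix},$$ $$\check V_1\mapsto\begin{pmatrix}0&-i e^{S_1}\\ i e^{-S_1}&u_1-u_1^{-1}\end{pmatrix},\qquad \check V_0\mapsto\begin{pmatrix}u_0&0\\ s&-u_0^{-1}\end{pmatrix}$$ extends to an injective homomorphism of unital $\mathbb C$-algebras $\mathcal H\to \mathrm{Mat}(2,\mathbb T_q)$. In particular the four matrices are invertible, i.e. lie in $GL(2,\mathbb T_q)$, and satisfy (under the matrix product over the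 noncommutative ring $\mathbb T_q$) the four quadratic relations and the relation $\check V_1V_1V_0\check V_0=q^{-1/2}$ above. -/

import Mathlib

open Complex

noncomputable section

/-- The quantum torus `𝕋_q`, `q = exp (-iπħ)`: its elements are the finite linear combinations of the
symbols `e^{a S₁ + b S₂}`, `(a, b) ∈ ℤ²`, and the product is
`e^A * e^B = exp ([A, B] / 2) e^{A + B}` with `[S₁, S₂] = iπħ`. -/
def QuantumTorus (_ħ : ℂ) : Type := (ℤ × ℤ) →₀ ℂ

namespace QuantumTorus

variable (ħ : ℂ)

instance : AddCommGroup (QuantumTorus ħ) := inferInstanceAs (AddCommGroup ((ℤ × ℤ) →₀ ℂ))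
instance : Module ℂ (QuantumTorus ħ) := inferInstanceAs (Module ℂ ((ℤ × ℤ) →₀ ℂ))

/-- The monomial `z e^{a S₁ + b S₂}` for `m = (a, b)`. -/
def mono (m : ℤ × ℤ) : ℂ →ₗ[ℂ] QuantumTorus ħ := Finsupp.lsingle m

/-- The scalar `exp ([A, B] / 2)` for `A = m.1 S₁ + m.2 S₂`, `B = n.1 S₁ + n.2 S₂`. -/
def cocycle (m n : ℤ × ℤ) : ℂ :=
  exp (I * Real.pi * ħ * ((m.1 * n.2 - m.2 * n.1 : ℤ) : ℂ) / 2)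

/-- The product of the quantum torus, as a bilinear map. -/
def mulLin : QuantumTorus ħ →ₗ[ℂ] QuantumTorus ħ →ₗ[ℂ] QuantumTorus ħ :=
  Finsupp.lsum ℂ fun m => LinearMap.toSpanSingleton ℂ (QuantumTorus ħ →ₗ[ℂ] QuantumTorus ħ)
    (Finsupp.lsum ℂ fun n => cocycle ħ m n • mono ħ (m + n))

instance : Mul (QuantumTorus ħ) := ⟨fun x y => mulLin ħ x y⟩
instance : One (QuantumTorus ħ) := ⟨mono ħ 0 1⟩

variable {ħ}

theorem mul_def (x y : QuantumTorus ħ) : x * y = mulLin ħ x y := rfl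

theorem one_def : (1 : QuantumTorus ħ) = mono ħ 0 1 := rfl

theorem mono_mul_mono (m n : ℤ × ℤ) (z w : ℂ) :
    mono ħ m z * mono ħ n w = mono ħ (m + n) (z * w * cocycle ħ m n) := by
  have h : mulLin ħ (mono ħ m z) =
      z • (Finsupp.lsum ℂ fun n => cocycle ħ m n • mono ħ (m + n) :
        ((ℤ × ℤ) →₀ ℂ) →ₗ[ℂ] QuantumTorus ħ) := by
    exact Finsupp.lsum_single _ _ _ _
  have h2 : (Finsupp.lsum ℂ fun n => cocycle ħ m n • mono ħ (m + n) :
        ((ℤ × ℤ) →₀ ℂ) →ₗ[ℂ] QuantumTorus ħ) (mono ħ n w) =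
      (cocycle ħ m n • mono ħ (m + n)) w := Finsupp.lsum_single _ _ _ _
  rw [mul_def, h]
  refine (congrArg (z • ·) h2).trans ?_
  simp only [LinearMap.smul_apply, ← map_smul, smul_eq_mul]
  congr 1
  ring

theorem induction_mono {p : QuantumTorus ħ → Prop} (x : QuantumTorus ħ) (h0 : p 0)
    (hadd : ∀ x y, p x → p y → p (x + y)) (hm : ∀ m z, p (mono ħ m z)) : p x :=
  Finsupp.induction_linear x h0 hadd hm

theorem cocycle_assoc (m n k : ℤ × ℤ) :
    cocycle ħ m n * cocycle ħ (m + n) k = cocycle ħ n k * cocycle ħ m (n + k) := by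
  simp only [cocycle, ← Complex.exp_add]
  congr 1
  push_cast [Prod.fst_add, Prod.snd_add]
  ring

instance : Ring (QuantumTorus ħ) :=
  { (inferInstance : AddCommGroup (QuantumTorus ħ)) with
    mul := (· * ·)
    one := 1
    left_distrib := fun x y z => by simp only [mul_def, map_add]
    right_distrib := fun x y z => by simp only [mul_def, map_add, LinearMap.add_apply]
    zero_mul := fun x => by simp only [mul_def, map_zero, LinearMap.zero_apply]
    mul_zero := fun x => by simp only [mul_def, map_zero]
    one_mul := fun x => by
      induction x using induction_mono with
      | h0 => simp only [mul_def, map_zero]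
      | hadd x y hx hy => rw [mul_def] at *; rw [map_add, hx, hy]
      | hm m z => rw [one_def, mono_mul_mono]; simp [cocycle]
    mul_one := fun x => by
      induction x using induction_mono with
      | h0 => simp only [mul_def, map_zero, LinearMap.zero_apply]
      | hadd x y hx hy => rw [mul_def] at *; rw [map_add, LinearMap.add_apply, hx, hy]
      | hm m z => rw [one_def, mono_mul_mono]; simp [cocycle]
    mul_assoc := fun x y z => by
      induction x using induction_mono with
      | h0 => simp only [mul_def, map_zero, LinearMap.zero_apply]
      | hadd x x' hx hx' =>
        simp only [mul_def, map_add, LinearMap.add_apply] at *; rw [hx, hx']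
      | hm m a =>
        induction y using induction_mono with
        | h0 => simp only [mul_def, map_zero, LinearMap.zero_apply]
        | hadd y y' hy hy' =>
          simp only [mul_def, map_add, LinearMap.add_apply] at *; rw [hy, hy']
        | hm n b =>
          induction z using induction_mono with
          | h0 => simp only [mul_def, map_zero]
          | hadd z z' hz hz' => simp only [mul_def, map_add] at *; rw [hz, hz']
          | hm k c =>
            simp only [mono_mul_mono, add_assoc]
            congr 1
            linear_combination (a * b * c) * cocycle_assoc (ħ := ħ) m n k }

instance : Algebra ℂ (QuantumTorus ħ) :=
  Algebra.ofModule
    (fun r x y => by simp only [mul_def, map_smul, LinearMap.smul_apply])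
    (fun r x y => by simp only [mul_def, map_smul])

/-- The exponential `e^{n₁ S₁ + n₂ S₂ + n₃ S₃}`, where `S₃` is the variable with
`[S₁, S₂] = [S₂, S₃] = [S₃, S₁] = iπħ` and `u₀ = -i e^{-S₁-S₂-S₃}`; since `S₁ + S₂ + S₃` is central,
this is `(e^{S₁+S₂+S₃})^{n₃} e^{(n₁-n₃) S₁ + (n₂-n₃) S₂}` with `e^{S₁+S₂+S₃} = -i / u₀`. -/
def qexp (ħ : ℂ) (u₀ : ℂˣ) (n₁ n₂ n₃ : ℤ) : QuantumTorus ħ :=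
  mono ħ (n₁ - n₃, n₂ - n₃) ((-I / (u₀ : ℂ)) ^ n₃)

theorem qexp_zero (u₀ : ℂˣ) : qexp ħ u₀ 0 0 0 = 1 := by
  simp only [qexp, one_def, sub_zero, zpow_zero]; rfl

/-- `e^A e^B = exp ([A, B] / 2) e^{A + B}` for integer combinations `A`, `B` of `S₁, S₂, S₃`, with
`[S₁, S₂] = [S₂, S₃] = [S₃, S₁] = iπħ`. -/
theorem qexp_mul_qexp (u₀ : ℂˣ) (m₁ m₂ m₃ n₁ n₂ n₃ : ℤ) :
    qexp ħ u₀ m₁ m₂ m₃ * qexp ħ u₀ n₁ n₂ n₃ =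
      exp (I * Real.pi * ħ * (((m₁ * n₂ - m₂ * n₁) + (m₂ * n₃ - m₃ * n₂) +
        (m₃ * n₁ - m₁ * n₃) : ℤ) : ℂ) / 2) • qexp ħ u₀ (m₁ + n₁) (m₂ + n₂) (m₃ + n₃) := by
  have h : (-I / (u₀ : ℂ)) ≠ 0 := div_ne_zero (neg_ne_zero.2 I_ne_zero) u₀.ne_zero
  simp only [qexp, mono_mul_mono, ← map_smul, smul_eq_mul, zpow_add₀ h, cocycle, Prod.mk_add_mk]
  have e1 : m₁ - m₃ + (n₁ - n₃) = m₁ + n₁ - (m₃ + n₃) := by ring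
  have e2 : m₂ - m₃ + (n₂ - n₃) = m₂ + n₂ - (m₃ + n₃) := by ring
  have e3 : (m₁ - m₃) * (n₂ - n₃) - (m₂ - m₃) * (n₁ - n₃) =
      (m₁ * n₂ - m₂ * n₁) + (m₂ * n₃ - m₃ * n₂) + (m₃ * n₁ - m₁ * n₃) := by ring
  rw [e1, e2, e3, mul_comm]

/-- `u₀ = -i e^{-S₁-S₂-S₃}`. -/
theorem algebraMap_u₀ (u₀ : ℂˣ) :
    algebraMap ℂ (QuantumTorus ħ) u₀ = -I • qexp ħ u₀ (-1) (-1) (-1) := by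
  rw [Algebra.algebraMap_eq_smul_one, one_def, qexp, ← map_smul, ← map_smul]
  congr 1
  have := u₀.ne_zero
  simp only [smul_eq_mul, zpow_neg, zpow_one, inv_div, mul_one]
  field_simp [I_ne_zero]

end QuantumTorus

/-- The four generators `V₀, V₁, V̌₁, V̌₀`; a prime stands for the check accent. -/
inductive CherednikGen : Type
  | V₀ | V₁ | V₁' | V₀'

/-- The defining relations of the Cherednik algebra of type `Č₁C₁`; `r` is the scalar `q^{-1/2}`. -/
inductive CherednikRel (k₀ k₁ u₀ u₁ r : ℂˣ) :
    FreeAlgebra ℂ CherednikGen → FreeAlgebra ℂ CherednikGen → Prop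
  | hecke_V₀ : CherednikRel k₀ k₁ u₀ u₁ r
      ((FreeAlgebra.ι ℂ .V₀ - algebraMap ℂ _ k₀) *
        (FreeAlgebra.ι ℂ .V₀ + algebraMap ℂ _ (k₀ : ℂ)⁻¹)) 0
  | hecke_V₁ : CherednikRel k₀ k₁ u₀ u₁ r
      ((FreeAlgebra.ι ℂ .V₁ - algebraMap ℂ _ k₁) *
        (FreeAlgebra.ι ℂ .V₁ + algebraMap ℂ _ (k₁ : ℂ)⁻¹)) 0
  | hecke_V₀' : CherednikRel k₀ k₁ u₀ u₁ r
      ((FreeAlgebra.ι ℂ .V₀' - algebraMap ℂ _ u₀) *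
        (FreeAlgebra.ι ℂ .V₀' + algebraMap ℂ _ (u₀ : ℂ)⁻¹)) 0
  | hecke_V₁' : CherednikRel k₀ k₁ u₀ u₁ r
      ((FreeAlgebra.ι ℂ .V₁' - algebraMap ℂ _ u₁) *
        (FreeAlgebra.ι ℂ .V₁' + algebraMap ℂ _ (u₁ : ℂ)⁻¹)) 0
  | prod : CherednikRel k₀ k₁ u₀ u₁ r
      (FreeAlgebra.ι ℂ .V₁' * FreeAlgebra.ι ℂ .V₁ * FreeAlgebra.ι ℂ .V₀ * FreeAlgebra.ι ℂ .V₀')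
      (algebraMap ℂ _ r)

/-- The scalar `q^t`, `t ∈ ℂ`, for `q = exp (-iπħ)`. -/
def qPow (ħ t : ℂ) : ℂˣ := Units.mk0 (exp (-(I * Real.pi * ħ) * t)) (exp_ne_zero _)

/-- The Cherednik algebra `ℋ` of type `Č₁C₁` with parameters `k₀, k₁, u₀, u₁` and `q = exp (-iπħ)`,
given by generators and relations. -/
abbrev CherednikAlgebra (ħ : ℂ) (k₀ k₁ u₀ u₁ : ℂˣ) : Type :=
  RingQuot (CherednikRel k₀ k₁ u₀ u₁ (qPow ħ (-1 / 2)))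

/-- The image of a generator in the Cherednik algebra. -/
def CherednikAlgebra.gen (ħ : ℂ) (k₀ k₁ u₀ u₁ : ℂˣ) (g : CherednikGen) :
    CherednikAlgebra ħ k₀ k₁ u₀ u₁ :=
  RingQuot.mkAlgHom ℂ _ (FreeAlgebra.ι ℂ g)

/-- The scalar `k̄ = k - k⁻¹`. -/
def barParam (k : ℂˣ) : ℂ := (k : ℂ) - (k : ℂ)⁻¹

/-- The lower left entry of the matrix of `V̌₀`. -/
def sEntry (ħ : ℂ) (k₀ k₁ u₀ u₁ : ℂˣ) : QuantumTorus ħ :=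
  let e := QuantumTorus.qexp ħ u₀
  I • e (-1) (-1) 1 + I • e (-1) 1 1 - barParam k₀ • e (-1) (-1) 0 - barParam k₁ • e (-1) 0 1
    - barParam u₁ • e 0 1 1 - algebraMap ℂ _ (u₀ : ℂ)

/-- The `2 × 2` matrices over the quantum torus assigned to the generators. -/
def repMatrix (ħ : ℂ) (k₀ k₁ u₀ u₁ : ℂˣ) : CherednikGen → Matrix (Fin 2) (Fin 2) (QuantumTorus ħ) :=
  let e := QuantumTorus.qexp ħ u₀
  let c := algebraMap ℂ (QuantumTorus ħ)
  fun
  | .V₀ => !![c (barParam k₀) - I • e 0 0 (-1), -(I • e 0 0 (-1));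
              -c (barParam k₀) + I • e 0 0 (-1) + I • e 0 0 1, I • e 0 0 (-1)]
  | .V₁ => !![c (barParam k₁) - I • e 0 1 0,
                c (barParam k₁) - I • e 0 (-1) 0 - I • e 0 1 0;
              I • e 0 1 0, I • e 0 1 0]
  | .V₁' => !![0, -(I • e 1 0 0);
               I • e (-1) 0 0, c (barParam u₁)]
  | .V₀' => !![c u₀, 0;
               sEntry ħ k₀ k₁ u₀ u₁, -c (u₀ : ℂ)⁻¹]

end

/-!
The algebra is denoted by `ℋ`; its generators `V̌₁, V₁, V₀, V̌₀` are abbreviated to `a, b, c, d`, so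
that `abcd = q^{-1/2}`. The relations between the four matrices are computations with monomials; the
last one is checked in the form `cd = q^{-1/2} b⁻¹ a⁻¹` (`repMatrix_V₀_mul_V₀'`).

Injectivity rests on a normal form in `ℋ` and a leading term argument in `Mat(2, 𝕋_q)`.

*Normal form.* Put `X = ab`. Since `a = X b⁻¹` and `d` is an affine function of `X c`, the algebra is
generated by `X^{±1}, b, c`, and the Hecke relations for `a` and `d` become straightening rules that
move the powers of `X` to the left of `b` and of `c`. Hence every element is a combination
`∑ xᵢ wᵢ` with `xᵢ ∈ ℂ[X, X⁻¹]` and `wᵢ` alternating words in `b` and `c`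
(`CherednikAlgebra.exists_mem_normalForm`).

*Leading terms.* Give `e^{α S₁ + β S₂}` the degree `α - β` and the matrix units `E₁₂` and `E₂₁` the
degrees `-1` and `1`. In the resulting filtration of `Mat(2, 𝕋_q)`, `a` and `b` have degree `0`,
`c` has degree `1` with leading part `p E₂₁`, `p ≠ 0`, and the leading part of `X^j` is lower
triangular, its diagonal entries being multiples of `e^{± j (S₁ + S₂)}`. The leading part of
`(bc)ⁿ`, `n > 0`, is a nonzero multiple of `E₁₁`. The four families of words with exactly `n > 0`
letters `c`, namely `(bc)ⁿ`, `(bc)ⁿ b`, `c(bc)ⁿ⁻¹` and `c(bc)ⁿ⁻¹ b`, have degree `n`. In the leading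
part of a combination `x₁(bc)ⁿ + x₂(bc)ⁿ b + x₃ c(bc)ⁿ⁻¹ + x₄ c(bc)ⁿ⁻¹ b` the first row involves
only `x₁` and `x₂`, and, as `𝕋_q` has no zero divisors, it vanishes only if both do; the second row
then yields `x₃ = x₄ = 0`. Induction on `n` shows that no nonzero normal form is in the kernel
(`CherednikAlgebra.eq_zero_of_mem_normalForm`).
-/

open Complex

noncomputable section

/-! ### The relations between the matrices -/

namespace QuantumTorus

variable {ħ : ℂ}

/-- The monomial `e^{a S₁ + b S₂}`. -/
def e (ħ : ℂ) (a b : ℤ) : QuantumTorus ħ := mono ħ (a, b) 1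

theorem mono_eq_smul_e (a b : ℤ) (z : ℂ) : mono ħ (a, b) z = z • e ħ a b := by
  rw [e, ← map_smul, smul_eq_mul, mul_one]

theorem one_eq_e : (1 : QuantumTorus ħ) = e ħ 0 0 := rfl

/-- The product of monomials, with the scalar written as an integer power of `q^{-1/2}`. -/
theorem e_mul_e (a b c d : ℤ) :
    e ħ a b * e ħ c d = exp (-(I * Real.pi * ħ) * (-1 / 2)) ^ (a * d - b * c) •
      e ħ (a + c) (b + d) := by
  rw [e, e, mono_mul_mono, Prod.mk_add_mk, mono_eq_smul_e, cocycle, ← Complex.exp_int_mul]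
  congr 2
  simp only [one_mul]
  ring_nf

theorem algebraMap_eq_smul_e (z : ℂ) : algebraMap ℂ (QuantumTorus ħ) z = z • e ħ 0 0 := by
  rw [Algebra.algebraMap_eq_smul_one, one_eq_e]

theorem qexp_eq_smul_e (u₀ : ℂˣ) (n₁ n₂ n₃ : ℤ) :
    qexp ħ u₀ n₁ n₂ n₃ = (-I / (u₀ : ℂ)) ^ n₃ • e ħ (n₁ - n₃) (n₂ - n₃) := by
  rw [qexp, mono_eq_smul_e]

end QuantumTorus

open QuantumTorus

section

variable (ħ : ℂ) (k₀ k₁ u₀ u₁ : ℂˣ)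

theorem repMatrix_V₀ : repMatrix ħ k₀ k₁ u₀ u₁ .V₀ =
    !![barParam k₀ • e ħ 0 0 + (u₀ : ℂ) • e ħ 1 1, (u₀ : ℂ) • e ħ 1 1;
      -barParam k₀ • e ħ 0 0 - (u₀ : ℂ) • e ħ 1 1 + (u₀ : ℂ)⁻¹ • e ħ (-1) (-1),
        -(u₀ : ℂ) • e ħ 1 1] := by
  have hI : I * (-I / u₀)⁻¹ = -(u₀ : ℂ) := by
    rw [inv_div, div_neg, mul_neg, mul_div_cancel₀ _ I_ne_zero]
  have hI' : I * (-I / u₀) = (u₀ : ℂ)⁻¹ := by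
    rw [← mul_div_assoc, mul_neg, I_mul_I, neg_neg, one_div]
  simp only [repMatrix, qexp_eq_smul_e, algebraMap_eq_smul_e, smul_smul, zpow_neg, zpow_one,
    hI, hI', neg_smul, neg_neg, sub_neg_eq_add, zero_sub, ← sub_eq_add_neg,
    zero_add]

theorem repMatrix_V₁ : repMatrix ħ k₀ k₁ u₀ u₁ .V₁ =
    !![barParam k₁ • e ħ 0 0 - I • e ħ 0 1,
        barParam k₁ • e ħ 0 0 - I • e ħ 0 (-1) - I • e ħ 0 1;
      I • e ħ 0 1, I • e ħ 0 1] := by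
  simp only [repMatrix, qexp_eq_smul_e, algebraMap_eq_smul_e]
  norm_num

theorem repMatrix_V₁' : repMatrix ħ k₀ k₁ u₀ u₁ .V₁' =
    !![0, -I • e ħ 1 0; I • e ħ (-1) 0, barParam u₁ • e ħ 0 0] := by
  simp only [repMatrix, qexp_eq_smul_e, algebraMap_eq_smul_e]
  norm_num

theorem repMatrix_V₀' : repMatrix ħ k₀ k₁ u₀ u₁ .V₀' =
    !![(u₀ : ℂ) • e ħ 0 0, 0;
      (u₀ : ℂ)⁻¹ • e ħ (-2) (-2) + (u₀ : ℂ)⁻¹ • e ħ (-2) 0 - barParam k₀ • e ħ (-1) (-1)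
        + (I * barParam k₁ * (u₀ : ℂ)⁻¹) • e ħ (-2) (-1)
        + (I * barParam u₁ * (u₀ : ℂ)⁻¹) • e ħ (-1) 0 - (u₀ : ℂ) • e ħ 0 0,
      -(u₀ : ℂ)⁻¹ • e ħ 0 0] := by
  have h : (u₀ : ℂ) ≠ 0 := u₀.ne_zero
  simp only [repMatrix, sEntry, qexp_eq_smul_e, algebraMap_eq_smul_e]
  congr 1
  have hI : I * (-I / u₀) = (u₀ : ℂ)⁻¹ := by
    rw [← mul_div_assoc, mul_neg, I_mul_I, neg_neg, one_div]
  ext i j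
  fin_cases i <;> fin_cases j <;> norm_num [smul_smul, hI]
  match_scalars <;> ring_nf

theorem algebraMap_matrix (z : ℂ) :
    algebraMap ℂ (Matrix (Fin 2) (Fin 2) (QuantumTorus ħ)) z =
      !![z • e ħ 0 0, 0; 0, z • e ħ 0 0] := by
  ext i j
  fin_cases i <;> fin_cases j <;> simp [Matrix.algebraMap_matrix_apply, algebraMap_eq_smul_e]

theorem hecke_repMatrix_V₀ :
    (repMatrix ħ k₀ k₁ u₀ u₁ .V₀ - algebraMap ℂ _ (k₀ : ℂ)) *
      (repMatrix ħ k₀ k₁ u₀ u₁ .V₀ + algebraMap ℂ _ (k₀ : ℂ)⁻¹) = 0 := by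
  have h : (u₀ : ℂ) ≠ 0 := u₀.ne_zero
  have h' : (k₀ : ℂ) ≠ 0 := k₀.ne_zero
  rw [repMatrix_V₀, algebraMap_matrix, algebraMap_matrix]
  ext i j
  fin_cases i <;> fin_cases j <;>
    simp [Matrix.mul_apply, mul_add, add_mul, mul_sub, sub_mul, e_mul_e, smul_smul, barParam] <;>
    match_scalars <;> field_simp <;> ring_nf

theorem hecke_repMatrix_V₁ :
    (repMatrix ħ k₀ k₁ u₀ u₁ .V₁ - algebraMap ℂ _ (k₁ : ℂ)) *
      (repMatrix ħ k₀ k₁ u₀ u₁ .V₁ + algebraMap ℂ _ (k₁ : ℂ)⁻¹) = 0 := by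
  have h' : (k₁ : ℂ) ≠ 0 := k₁.ne_zero
  rw [repMatrix_V₁, algebraMap_matrix, algebraMap_matrix]
  ext i j
  fin_cases i <;> fin_cases j <;>
    simp [Matrix.mul_apply, mul_add, mul_sub, sub_mul, e_mul_e, smul_smul, barParam] <;>
    match_scalars <;> field_simp <;> ring_nf <;> simp only [I_sq] <;> ring_nf

theorem hecke_repMatrix_V₁' :
    (repMatrix ħ k₀ k₁ u₀ u₁ .V₁' - algebraMap ℂ _ (u₁ : ℂ)) *
      (repMatrix ħ k₀ k₁ u₀ u₁ .V₁' + algebraMap ℂ _ (u₁ : ℂ)⁻¹) = 0 := by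
  have h' : (u₁ : ℂ) ≠ 0 := u₁.ne_zero
  rw [repMatrix_V₁', algebraMap_matrix, algebraMap_matrix]
  ext i j
  fin_cases i <;> fin_cases j <;>
    simp [Matrix.mul_apply, mul_add, sub_mul, e_mul_e, smul_smul, barParam] <;>
    match_scalars <;> field_simp <;> ring_nf

theorem hecke_repMatrix_V₀' :
    (repMatrix ħ k₀ k₁ u₀ u₁ .V₀' - algebraMap ℂ _ (u₀ : ℂ)) *
      (repMatrix ħ k₀ k₁ u₀ u₁ .V₀' + algebraMap ℂ _ (u₀ : ℂ)⁻¹) = 0 := by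
  have h' : (u₀ : ℂ) ≠ 0 := u₀.ne_zero
  rw [repMatrix_V₀', algebraMap_matrix, algebraMap_matrix]
  ext i j
  fin_cases i <;> fin_cases j <;>
    simp [Matrix.mul_apply, mul_add, add_mul, mul_sub, sub_mul, e_mul_e]
  all_goals match_scalars <;> field_simp <;> ring_nf

/-- `V₀ V̌₀ = q^{-1/2} V₁⁻¹ V̌₁⁻¹`, with the inverses expressed by the Hecke relations. -/
theorem repMatrix_V₀_mul_V₀' :
    repMatrix ħ k₀ k₁ u₀ u₁ .V₀ * repMatrix ħ k₀ k₁ u₀ u₁ .V₀' =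
      algebraMap ℂ _ (exp (-(I * Real.pi * ħ) * (-1 / 2))) *
      ((repMatrix ħ k₀ k₁ u₀ u₁ .V₁ - algebraMap ℂ _ (barParam k₁)) *
        (repMatrix ħ k₀ k₁ u₀ u₁ .V₁' - algebraMap ℂ _ (barParam u₁))) := by
  have h' : (u₀ : ℂ) ≠ 0 := u₀.ne_zero
  have ht : exp (-(I * Real.pi * ħ) * (-1 / 2)) ≠ 0 := exp_ne_zero _
  rw [repMatrix_V₀', repMatrix_V₀, repMatrix_V₁, repMatrix_V₁', algebraMap_matrix,
    algebraMap_matrix, algebraMap_matrix]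
  ext i j
  fin_cases i <;> fin_cases j <;>
    simp [-Matrix.cons_mul, Matrix.mul_apply, Fin.sum_univ_two, mul_add, add_mul, mul_sub,
      sub_mul, e_mul_e, smul_smul]
  all_goals match_scalars <;> field_simp <;> ring_nf <;>
    simp only [I_sq] <;> ring_nf

end

/-! ### Leading terms over the quantum torus -/

namespace QuantumTorus

variable {ħ : ℂ}

/-- The coefficient of the monomial `e^{a S₁ + b S₂}` for `k = (a, b)`. -/
def coeff (k : ℤ × ℤ) : QuantumTorus ħ →ₗ[ℂ] ℂ := Finsupp.lapply k

theorem coeff_mono (k m : ℤ × ℤ) (z : ℂ) : coeff k (mono ħ m z) = if m = k then z else 0 :=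
  Finsupp.single_apply

theorem exists_support (x : QuantumTorus ħ) :
    ∃ s : Finset (ℤ × ℤ), (∀ k, k ∈ s ↔ coeff k x ≠ 0) ∧ x = ∑ k ∈ s, mono ħ k (coeff k x) :=
  ⟨Finsupp.support x, fun _ => Finsupp.mem_support_iff, (Finsupp.sum_single x).symm⟩

theorem mono_ne_zero {m : ℤ × ℤ} {z : ℂ} (hz : z ≠ 0) : mono ħ m z ≠ 0 :=
  Finsupp.single_ne_zero.2 hz

theorem cocycle_ne_zero (m n : ℤ × ℤ) : cocycle ħ m n ≠ 0 := exp_ne_zero _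

/-- `ℤ²` is an orderable group, so in a product of two nonzero elements some monomial arises from
only one pair of monomials of the factors. -/
instance : NoZeroDivisors (QuantumTorus ħ) where
  eq_zero_or_eq_zero_of_mul_eq_zero {x y} h := by
    by_contra! hxy
    obtain ⟨s, hs, hxs⟩ := exists_support x
    obtain ⟨t, ht, hyt⟩ := exists_support y
    have hs0 : s.Nonempty := Finset.nonempty_iff_ne_empty.2 fun h0 => hxy.1 <| by
      rw [hxs, h0, Finset.sum_empty]
    have ht0 : t.Nonempty := Finset.nonempty_iff_ne_empty.2 fun h0 => hxy.2 <| by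
      rw [hyt, h0, Finset.sum_empty]
    obtain ⟨m, hm, n, hn, hu⟩ := UniqueSums.uniqueAdd_of_nonempty hs0 ht0
    have h0 : coeff (m + n) (x * y) = coeff m x * coeff n y * cocycle ħ m n := by
      conv_lhs => rw [hxs, hyt, Finset.sum_mul_sum, map_sum]
      rw [Finset.sum_eq_single_of_mem m hm, map_sum, Finset.sum_eq_single_of_mem n hn,
        mono_mul_mono, coeff_mono, if_pos rfl]
      · intro b hb hbn
        rw [mono_mul_mono, coeff_mono, if_neg fun h' => hbn (hu hm hb h').2]
      · intro a ha ham
        rw [map_sum]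
        refine Finset.sum_eq_zero fun b hb => ?_
        rw [mono_mul_mono, coeff_mono, if_neg fun h' => ham (hu ha hb h').1]
    rw [h, map_zero] at h0
    exact mul_ne_zero (mul_ne_zero ((hs m).1 hm) ((ht n).1 hn)) (cocycle_ne_zero m n) h0.symm

/-- The span of the monomials `e^{a S₁ + b S₂}` with `a - b ≤ n`. -/
def degreeLE (ħ : ℂ) (n : ℤ) : Submodule ℂ (QuantumTorus ħ) :=
  Submodule.span ℂ {x | ∃ a b : ℤ, a - b ≤ n ∧ x = e ħ a b}

/-- The homogeneous part of degree `n`, where `e^{a S₁ + b S₂}` has degree `a - b`. -/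
def part (n : ℤ) : QuantumTorus ħ →ₗ[ℂ] QuantumTorus ħ :=
  Finsupp.lsum ℂ fun m : ℤ × ℤ => if m.1 - m.2 = n then mono ħ m else 0

theorem part_e (n a b : ℤ) : part n (e ħ a b) = if a - b = n then e ħ a b else 0 := by
  have : part n (e ħ a b) = (if a - b = n then mono ħ (a, b) else 0) 1 :=
    Finsupp.lsum_single _ _ _ _
  rw [this]
  split_ifs <;> rfl

theorem e_mem_degreeLE {n a b : ℤ} (h : a - b ≤ n) : e ħ a b ∈ degreeLE ħ n :=
  Submodule.subset_span ⟨a, b, h, rfl⟩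

theorem degreeLE_mono {m n : ℤ} (h : m ≤ n) : degreeLE ħ m ≤ degreeLE ħ n := by
  refine Submodule.span_mono ?_
  rintro _ ⟨a, b, hab, rfl⟩
  exact ⟨a, b, hab.trans h, rfl⟩

theorem part_eq_zero {m n : ℤ} (h : m < n) {x : QuantumTorus ħ} (hx : x ∈ degreeLE ħ m) :
    part n x = 0 := by
  induction hx using Submodule.span_induction with
  | mem x hx => obtain ⟨a, b, hab, rfl⟩ := hx; rw [part_e, if_neg (by omega)]
  | zero => exact map_zero _
  | add x y _ _ hx hy => rw [map_add, hx, hy, add_zero]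
  | smul c x _ hx => rw [map_smul, hx, smul_zero]

theorem mul_mem_degreeLE {m n : ℤ} {x y : QuantumTorus ħ} (hx : x ∈ degreeLE ħ m)
    (hy : y ∈ degreeLE ħ n) : x * y ∈ degreeLE ħ (m + n) := by
  induction hx, hy using Submodule.span_induction₂ with
  | mem_mem x y hx hy =>
    obtain ⟨a, b, hab, rfl⟩ := hx
    obtain ⟨c, d, hcd, rfl⟩ := hy
    rw [e_mul_e]
    exact Submodule.smul_mem _ _ (e_mem_degreeLE (by omega))
  | zero_left y _ => rw [zero_mul]; exact zero_mem _
  | zero_right x _ => rw [mul_zero]; exact zero_mem _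
  | add_left x y z _ _ _ h h' => rw [add_mul]; exact add_mem h h'
  | add_right x y z _ _ _ h h' => rw [mul_add]; exact add_mem h h'
  | smul_left r x y _ _ h => rw [smul_mul_assoc]; exact Submodule.smul_mem _ _ h
  | smul_right r x y _ _ h => rw [mul_smul_comm]; exact Submodule.smul_mem _ _ h

theorem part_mul {m n : ℤ} {x y : QuantumTorus ħ} (hx : x ∈ degreeLE ħ m)
    (hy : y ∈ degreeLE ħ n) : part (m + n) (x * y) = part m x * part n y := by
  induction hx, hy using Submodule.span_induction₂ with
  | mem_mem x y hx hy =>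
    obtain ⟨a, b, hab, rfl⟩ := hx
    obtain ⟨c, d, hcd, rfl⟩ := hy
    rw [e_mul_e, map_smul, part_e, part_e, part_e]
    by_cases h1 : a - b = m
    · by_cases h2 : c - d = n
      · rw [if_pos h1, if_pos h2, if_pos (by omega), e_mul_e]
      · rw [if_neg h2, if_neg (by omega), mul_zero, smul_zero]
    · rw [if_neg h1, if_neg (by omega), zero_mul, smul_zero]
  | zero_left y _ => simp only [zero_mul, map_zero]
  | zero_right x _ => simp only [mul_zero, map_zero]
  | add_left x y z _ _ _ h h' => rw [add_mul, map_add, h, h', map_add, add_mul]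
  | add_right x y z _ _ _ h h' => rw [mul_add, map_add, h, h', map_add, mul_add]
  | smul_left r x y _ _ h => rw [smul_mul_assoc, map_smul, h, map_smul, smul_mul_assoc]
  | smul_right r x y _ _ h => rw [mul_smul_comm, map_smul, h, map_smul, mul_smul_comm]

/-- Matrices of degree at most `n`, where `E₁₂` has degree `-1` and `E₂₁` has degree `1`. -/
def matrixDegreeLE (ħ : ℂ) (n : ℤ) : Submodule ℂ (Matrix (Fin 2) (Fin 2) (QuantumTorus ħ)) where
  carrier := {M | ∀ i j : Fin 2, M i j ∈ degreeLE ħ (n + (j.val - i.val))}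
  add_mem' hM hN i j := add_mem (hM i j) (hN i j)
  zero_mem' _ _ := zero_mem _
  smul_mem' c _ hM i j := Submodule.smul_mem _ c (hM i j)

/-- The homogeneous part of degree `n` of a matrix, for the grading in which `E₁₂` has degree `-1`
and `E₂₁` has degree `1`. -/
def symb (n : ℤ) : Matrix (Fin 2) (Fin 2) (QuantumTorus ħ) →ₗ[ℂ]
    Matrix (Fin 2) (Fin 2) (QuantumTorus ħ) where
  toFun M := .of fun i j => part (n + (j.val - i.val)) (M i j)
  map_add' M N := by ext i j; exact map_add (part _) _ _
  map_smul' c M := by ext i j; exact map_smul (part _) _ _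

theorem symb_apply (n : ℤ) (M : Matrix (Fin 2) (Fin 2) (QuantumTorus ħ)) (i j : Fin 2) :
    symb n M i j = part (n + (j.val - i.val)) (M i j) := rfl

theorem matrixDegreeLE_mono {m n : ℤ} (h : m ≤ n) : matrixDegreeLE ħ m ≤ matrixDegreeLE ħ n :=
  fun _ hM i j => degreeLE_mono (add_le_add_left h _) (hM i j)

variable {M N : Matrix (Fin 2) (Fin 2) (QuantumTorus ħ)} {m n : ℤ}

theorem symb_eq_zero (h : m < n) (hM : M ∈ matrixDegreeLE ħ m) : symb n M = 0 := by
  ext i j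
  exact part_eq_zero (by omega) (hM i j)

theorem mul_mem_matrixDegreeLE (hM : M ∈ matrixDegreeLE ħ m) (hN : N ∈ matrixDegreeLE ħ n) :
    M * N ∈ matrixDegreeLE ħ (m + n) := fun i j => by
  rw [Matrix.mul_apply]
  refine Submodule.sum_mem _ fun k _ => ?_
  have := mul_mem_degreeLE (hM i k) (hN k j)
  convert this using 2
  ring

theorem symb_mul (hM : M ∈ matrixDegreeLE ħ m) (hN : N ∈ matrixDegreeLE ħ n) :
    symb (m + n) (M * N) = symb m M * symb n N := by
  ext i j
  rw [Matrix.mul_apply, symb_apply, Matrix.mul_apply, map_sum]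
  refine Finset.sum_congr rfl fun k _ => ?_
  rw [symb_apply, symb_apply, ← part_mul (hM i k) (hN k j)]
  congr 2
  ring

end QuantumTorus

/-! ### Normal forms in the Cherednik algebra -/

section NormalForm

variable {H : Type*} [Ring H] [Algebra ℂ H]

/-- The span of the integer powers of a unit. -/
def zpowSpan (X : Hˣ) : Submodule ℂ H :=
  Submodule.span ℂ (Set.range fun m : ℤ => ((X ^ m : Hˣ) : H))

theorem zpow_mem_zpowSpan (X : Hˣ) (m : ℤ) : ((X ^ m : Hˣ) : H) ∈ zpowSpan X :=
  Submodule.subset_span ⟨m, rfl⟩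

theorem val_mem_zpowSpan (X : Hˣ) : (X : H) ∈ zpowSpan X := by
  simpa using zpow_mem_zpowSpan X 1

theorem inv_mem_zpowSpan (X : Hˣ) : ((X⁻¹ : Hˣ) : H) ∈ zpowSpan X := by
  simpa using zpow_mem_zpowSpan X (-1)

theorem one_mem_zpowSpan (X : Hˣ) : (1 : H) ∈ zpowSpan X := by
  simpa using zpow_mem_zpowSpan X 0

theorem mul_mem_zpowSpan {X : Hˣ} {x y : H} (hx : x ∈ zpowSpan X) (hy : y ∈ zpowSpan X) :
    x * y ∈ zpowSpan X := by
  have h : zpowSpan X * zpowSpan X ≤ zpowSpan X := by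
    rw [zpowSpan, Submodule.span_mul_span, Submodule.span_le]
    rintro _ ⟨_, ⟨m, rfl⟩, _, ⟨n, rfl⟩, rfl⟩
    refine Submodule.subset_span ⟨m + n, ?_⟩
    simp only [zpow_add, Units.val_mul]
  exact h (Submodule.mul_mem_mul hx hy)

/-- Powers of `X` can be moved to the left of `b` as soon as `X` and `X⁻¹` can. -/
theorem exists_mul_eq_add_mul {X : Hˣ} {b : H}
    (h : ∃ y ∈ zpowSpan X, ∃ z ∈ zpowSpan X, b * X = y + z * b)
    (h' : ∃ y ∈ zpowSpan X, ∃ z ∈ zpowSpan X, b * (X⁻¹ : Hˣ) = y + z * b)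
    {x : H} (hx : x ∈ zpowSpan X) :
    ∃ y ∈ zpowSpan X, ∃ z ∈ zpowSpan X, b * x = y + z * b := by
  have step (x t : H) (ht : t ∈ zpowSpan X)
      (htb : ∃ y ∈ zpowSpan X, ∃ z ∈ zpowSpan X, b * t = y + z * b)
      (hx : ∃ y ∈ zpowSpan X, ∃ z ∈ zpowSpan X, b * x = y + z * b) :
      ∃ y ∈ zpowSpan X, ∃ z ∈ zpowSpan X, b * (x * t) = y + z * b := by
    obtain ⟨y, hy, z, hz, hb⟩ := htb
    obtain ⟨y', hy', z', hz', hb'⟩ := hx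
    refine ⟨y' * t + z' * y, add_mem (mul_mem_zpowSpan hy' ht) (mul_mem_zpowSpan hz' hy),
      z' * z, mul_mem_zpowSpan hz' hz, ?_⟩
    rw [← mul_assoc, hb', add_mul, mul_assoc z' b, hb]
    noncomm_ring
  induction hx using Submodule.span_induction with
  | mem x hx =>
    obtain ⟨m, rfl⟩ := hx
    induction m using Int.induction_on with
    | zero => exact ⟨0, zero_mem _, 1, one_mem_zpowSpan X, by simp⟩
    | succ i ih =>
      have := step _ _ (val_mem_zpowSpan X) h ih
      simpa only [zpow_add_one, Units.val_mul] using this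
    | pred i ih =>
      have := step _ _ (inv_mem_zpowSpan X) h' ih
      simpa only [zpow_sub_one, Units.val_mul] using this
  | zero => exact ⟨0, zero_mem _, 0, zero_mem _, by simp⟩
  | add x y _ _ hx hy =>
    obtain ⟨y₁, hy₁, z₁, hz₁, hb⟩ := hx
    obtain ⟨y₂, hy₂, z₂, hz₂, hb'⟩ := hy
    exact ⟨y₁ + y₂, add_mem hy₁ hy₂, z₁ + z₂, add_mem hz₁ hz₂, by
      rw [mul_add, hb, hb']; noncomm_ring⟩
  | smul r x _ hx =>
    obtain ⟨y, hy, z, hz, hb⟩ := hx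
    exact ⟨_, Submodule.smul_mem _ r hy, _, Submodule.smul_mem _ r hz, by
      rw [mul_smul_comm, hb, smul_add, smul_mul_assoc]⟩

/-- The alternating words in `b` and `c`: `(bc)ⁿ`, preceded by `c` if `p` and followed by `b`
if `s`. -/
def altWord (b c : H) (p : Bool) (n : ℕ) (s : Bool) : H :=
  (if p then c else 1) * (b * c) ^ n * (if s then b else 1)

/-- The span of the alternating words in `b` and `c`. -/
def altWordSpan (b c : H) : Submodule ℂ H :=
  Submodule.span ℂ {x | ∃ p n s, x = altWord b c p n s}

theorem altWord_mem (b c : H) (p : Bool) (n : ℕ) (s : Bool) :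
    altWord b c p n s ∈ altWordSpan b c := Submodule.subset_span ⟨p, n, s, rfl⟩

theorem one_mem_altWordSpan (b c : H) : (1 : H) ∈ altWordSpan b c := by
  simpa [altWord] using altWord_mem b c false 0 false

theorem first_mul_mem_altWordSpan {b c : H} {β : ℂ} (hb : b * b = β • b + 1) {x : H}
    (hx : x ∈ altWordSpan b c) : b * x ∈ altWordSpan b c := by
  induction hx using Submodule.span_induction with
  | mem x hx =>
    obtain ⟨p, n, s, rfl⟩ := hx
    cases p with
    | true =>
      convert altWord_mem b c false (n + 1) s using 1
      simp only [altWord, pow_succ']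
      simp [mul_assoc]
    | false =>
      cases n with
      | zero =>
        cases s with
        | false => simpa [altWord] using altWord_mem b c false 0 true
        | true =>
          have : b * altWord b c false 0 true = β • altWord b c false 0 true + 1 := by
            simpa [altWord] using hb
          rw [this]
          exact add_mem (Submodule.smul_mem _ _ (altWord_mem _ _ _ _ _)) (one_mem_altWordSpan b c)
      | succ n =>
        have : b * altWord b c false (n + 1) s =
            β • altWord b c false (n + 1) s + altWord b c true n s := by
          simp only [altWord, pow_succ', if_true, Bool.false_eq_true, if_false, one_mul,
            ← mul_assoc, hb, add_mul, smul_mul_assoc]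
        rw [this]
        exact add_mem (Submodule.smul_mem _ _ (altWord_mem _ _ _ _ _)) (altWord_mem _ _ _ _ _)
  | zero => rw [mul_zero]; exact zero_mem _
  | add x y _ _ hx hy => rw [mul_add]; exact add_mem hx hy
  | smul r x _ hx => rw [mul_smul_comm]; exact Submodule.smul_mem _ _ hx

theorem second_mul_mem_altWordSpan {b c : H} {γ : ℂ} (hc : c * c = γ • c + 1) {x : H}
    (hx : x ∈ altWordSpan b c) : c * x ∈ altWordSpan b c := by
  induction hx using Submodule.span_induction with
  | mem x hx =>
    obtain ⟨p, n, s, rfl⟩ := hx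
    cases p with
    | true =>
      have : c * altWord b c true n s = γ • altWord b c true n s + altWord b c false n s := by
        simp only [altWord, if_true, Bool.false_eq_true, if_false, one_mul,
          ← mul_assoc, hc, add_mul, smul_mul_assoc]
      rw [this]
      exact add_mem (Submodule.smul_mem _ _ (altWord_mem _ _ _ _ _)) (altWord_mem _ _ _ _ _)
    | false =>
      convert altWord_mem b c true n s using 1
      simp [altWord, mul_assoc]
  | zero => rw [mul_zero]; exact zero_mem _
  | add x y _ _ hx hy => rw [mul_add]; exact add_mem hx hy
  | smul r x _ hx => rw [mul_smul_comm]; exact Submodule.smul_mem _ _ hx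

/-- If left multiplication by `b` preserves `W` and powers of `X` can be moved to the left of `b`,
then left multiplication by `b` preserves `ℂ[X, X⁻¹] W`. -/
theorem mul_mem_zpowSpan_mul {X : Hˣ} {b : H} {W : Submodule ℂ H}
    (h : ∀ x ∈ zpowSpan X, ∃ y ∈ zpowSpan X, ∃ z ∈ zpowSpan X, b * x = y + z * b)
    (hW : ∀ w ∈ W, b * w ∈ W) {x : H} (hx : x ∈ zpowSpan X * W) : b * x ∈ zpowSpan X * W := by
  induction hx using Submodule.mul_induction_on' with
  | mem_mul_mem x hx w hw =>
    obtain ⟨y, hy, z, hz, e⟩ := h x hx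
    rw [← mul_assoc, e, add_mul, mul_assoc z]
    exact add_mem (Submodule.mul_mem_mul hy hw) (Submodule.mul_mem_mul hz (hW w hw))
  | add x _ y _ hx hy => rw [mul_add]; exact add_mem hx hy

/-- The elements `∑ xᵢ wᵢ` with `xᵢ ∈ ℂ[X, X⁻¹]` and `wᵢ` alternating words in `b` and `c` with at
most `N` letters `c`. -/
def normalForm (X : Hˣ) (b c : H) : ℕ → Submodule ℂ H
  | 0 => zpowSpan X ⊔ (zpowSpan X).map (LinearMap.mulRight ℂ b)
  | N + 1 => normalForm X b c N ⊔
    ((zpowSpan X).map (LinearMap.mulRight ℂ ((b * c) ^ (N + 1))) ⊔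
      (zpowSpan X).map (LinearMap.mulRight ℂ ((b * c) ^ (N + 1) * b))) ⊔
    ((zpowSpan X).map (LinearMap.mulRight ℂ (c * (b * c) ^ N)) ⊔
      (zpowSpan X).map (LinearMap.mulRight ℂ (c * (b * c) ^ N * b)))

theorem normalForm_mono (X : Hˣ) (b c : H) : Monotone (normalForm X b c) :=
  monotone_nat_of_le_succ fun _ => le_sup_left.trans le_sup_left

theorem mul_altWord_mem_normalForm {X : Hˣ} (b c : H) {x : H} (hx : x ∈ zpowSpan X)
    (p : Bool) (n : ℕ) (s : Bool) : ∃ N, x * altWord b c p n s ∈ normalForm X b c N := by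
  cases p with
  | true =>
    refine ⟨n + 1, Submodule.mem_sup_right ?_⟩
    cases s with
    | false => exact Submodule.mem_sup_left ⟨x, hx, by simp [altWord, mul_assoc]⟩
    | true => exact Submodule.mem_sup_right ⟨x, hx, by simp [altWord, mul_assoc]⟩
  | false =>
    refine ⟨n, ?_⟩
    cases n with
    | zero =>
      cases s with
      | false => exact Submodule.mem_sup_left (by simpa [altWord] using hx)
      | true => exact Submodule.mem_sup_right ⟨x, hx, by simp [altWord]⟩
    | succ n =>
      refine Submodule.mem_sup_left (Submodule.mem_sup_right ?_)
      cases s with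
      | false => exact Submodule.mem_sup_left ⟨x, hx, by simp [altWord]⟩
      | true => exact Submodule.mem_sup_right ⟨x, hx, by simp [altWord, mul_assoc]⟩

theorem exists_mem_normalForm {X : Hˣ} {b c x : H} (hx : x ∈ zpowSpan X * altWordSpan b c) :
    ∃ N, x ∈ normalForm X b c N := by
  have hadd {x y : H} (hx : ∃ N, x ∈ normalForm X b c N) (hy : ∃ N, y ∈ normalForm X b c N) :
      ∃ N, x + y ∈ normalForm X b c N := by
    obtain ⟨M, hM⟩ := hx
    obtain ⟨N, hN⟩ := hy
    exact ⟨max M N, add_mem (normalForm_mono X b c (le_max_left M N) hM)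
      (normalForm_mono X b c (le_max_right M N) hN)⟩
  induction hx using Submodule.mul_induction_on' with
  | mem_mul_mem x hx w hw =>
    induction hw using Submodule.span_induction with
    | mem w hw =>
      obtain ⟨p, n, s, rfl⟩ := hw
      exact mul_altWord_mem_normalForm b c hx p n s
    | zero => exact ⟨0, by rw [mul_zero]; exact zero_mem _⟩
    | add u v _ _ hu hv => rw [mul_add]; exact hadd hu hv
    | smul r u _ hu =>
      obtain ⟨N, hN⟩ := hu
      exact ⟨N, by rw [mul_smul_comm]; exact Submodule.smul_mem _ _ hN⟩
  | add x _ y _ hx hy => exact hadd hx hy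

end NormalForm

section HeckeRelation

variable {R : Type*} [Ring R] [Algebra ℂ R]

/-- The Hecke relation `(a - k)(a + k⁻¹) = 0` in the form `a² = k̄ a + 1`. -/
theorem mul_self_of_hecke {k : ℂˣ} {a : R}
    (h : (a - algebraMap ℂ R k) * (a + algebraMap ℂ R (k : ℂ)⁻¹) = 0) :
    a * a = barParam k • a + 1 := by
  have h1 : algebraMap ℂ R k * algebraMap ℂ R (k : ℂ)⁻¹ = 1 := by
    rw [← map_mul, mul_inv_cancel₀ k.ne_zero, map_one]
  have h2 := Algebra.commutes (k : ℂ)⁻¹ a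
  rw [barParam, Algebra.smul_def, map_sub, ← sub_eq_zero, ← h]
  simp only [sub_mul, mul_add, h1, h2]
  abel

theorem mul_sub_of_mul_self {κ : ℂ} {a : R} (h : a * a = κ • a + 1) :
    a * (a - algebraMap ℂ R κ) = 1 := by
  rw [mul_sub, h, ← Algebra.commutes, ← Algebra.smul_def, add_sub_cancel_left]

theorem sub_mul_of_mul_self {κ : ℂ} {a : R} (h : a * a = κ • a + 1) :
    (a - algebraMap ℂ R κ) * a = 1 := by
  rw [sub_mul, h, ← Algebra.smul_def, add_sub_cancel_left]

/-- An element satisfying a Hecke relation, as a unit. -/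
def heckeUnit {κ : ℂ} {a : R} (h : a * a = κ • a + 1) : Rˣ :=
  ⟨a, a - algebraMap ℂ R κ, mul_sub_of_mul_self h, sub_mul_of_mul_self h⟩

variable {α β γ δ r : ℂ} {a b c d : R} (ha : a * a = α • a + 1) (hb : b * b = β • b + 1)

theorem val_heckeUnit_mul : ((heckeUnit ha * heckeUnit hb : Rˣ) : R) = a * b := rfl

theorem val_heckeUnit_mul_inv : (((heckeUnit ha * heckeUnit hb)⁻¹ : Rˣ) : R) =
    (b - algebraMap ℂ R β) * (a - algebraMap ℂ R α) := by
  rw [mul_inv_rev, Units.val_mul]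
  rfl

/-- The Hecke relation for `a`, read as a straightening rule for `b` and `X = ab`. -/
theorem mul_heckeUnit_mul : b * (heckeUnit ha * heckeUnit hb : Rˣ) =
    β • ((heckeUnit ha * heckeUnit hb : Rˣ) : R) + α • 1 +
      ((heckeUnit ha * heckeUnit hb)⁻¹ : Rˣ) * b := by
  rw [val_heckeUnit_mul_inv, val_heckeUnit_mul]
  simp only [Algebra.algebraMap_eq_smul_one, sub_mul, mul_sub, smul_mul_assoc, mul_smul_comm,
    one_mul, mul_one, smul_add, smul_sub, mul_assoc, hb]
  module

theorem mul_heckeUnit_mul_inv : b * ((heckeUnit ha * heckeUnit hb)⁻¹ : Rˣ) =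
    -β • ((heckeUnit ha * heckeUnit hb : Rˣ) : R) - α • 1 +
      (heckeUnit ha * heckeUnit hb : Rˣ) * b := by
  rw [val_heckeUnit_mul_inv, val_heckeUnit_mul, ← mul_assoc, mul_sub_of_mul_self hb]
  simp only [Algebra.algebraMap_eq_smul_one, mul_add, mul_smul_comm, one_mul, mul_one, mul_assoc,
    hb]
  module

/-- `X c = r d⁻¹`. -/
theorem heckeUnit_mul_mul
    (hd : d * d = δ • d + 1) (hprod : a * b * c * d = algebraMap ℂ R r) :
    (heckeUnit ha * heckeUnit hb : Rˣ) * c =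
    r • (d - algebraMap ℂ R δ) := by
  have h := congrArg (· * (d - algebraMap ℂ R δ)) hprod
  simpa only [mul_assoc, mul_sub_of_mul_self hd, mul_one, ← Algebra.smul_def,
    val_heckeUnit_mul] using h

theorem heckeUnit_mul_inv_eq
    (hr : r ≠ 0)
    (hprod : a * b * c * d = algebraMap ℂ R r) :
    (((heckeUnit ha * heckeUnit hb)⁻¹ : Rˣ) : R) = r⁻¹ • (c * d) := by
  refine Units.inv_eq_of_mul_eq_one_right ?_
  rw [mul_smul_comm, val_heckeUnit_mul, ← mul_assoc, hprod, Algebra.algebraMap_eq_smul_one,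
    smul_smul, inv_mul_cancel₀ hr, one_smul]

theorem eq_add_smul_heckeUnit_mul
    (hd : d * d = δ • d + 1) (hr : r ≠ 0)
    (hprod : a * b * c * d = algebraMap ℂ R r) :
   
    d = δ • 1 + r⁻¹ • ((heckeUnit ha * heckeUnit hb : Rˣ) * c) := by
  rw [heckeUnit_mul_mul ha hb hd hprod, smul_smul, inv_mul_cancel₀ hr, one_smul,
    ← Algebra.algebraMap_eq_smul_one, add_sub_cancel]

/-- The Hecke relation for `d`, read as a straightening rule for `c` and `X⁻¹`. -/
theorem mul_heckeUnit_mul_inv'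
    (hc : c * c = γ • c + 1) (hd : d * d = δ • d + 1) (hr : r ≠ 0)
    (hprod : a * b * c * d = algebraMap ℂ R r) :
    c * ((heckeUnit ha * heckeUnit hb)⁻¹ : Rˣ) =
    γ • (((heckeUnit ha * heckeUnit hb)⁻¹ : Rˣ) : R) + (r⁻¹ * δ) • 1 +
      ((r⁻¹ * r⁻¹) • ((heckeUnit ha * heckeUnit hb : Rˣ) : R)) * c := by
  have h := eq_add_smul_heckeUnit_mul ha hb hd hr hprod
  rw [heckeUnit_mul_inv_eq ha hb hr hprod, mul_smul_comm, ← mul_assoc, hc, add_mul, one_mul]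
  conv_lhs => enter [2, 2]; rw [h]
  rw [smul_mul_assoc, smul_mul_assoc]
  module

theorem mul_heckeUnit_mul'
    (hc : c * c = γ • c + 1) (hd : d * d = δ • d + 1) (hr : r ≠ 0)
    (hprod : a * b * c * d = algebraMap ℂ R r) :
    c * (heckeUnit ha * heckeUnit hb : Rˣ) =
    (-(r * r) * γ) • (((heckeUnit ha * heckeUnit hb)⁻¹ : Rˣ) : R) - (r * δ) • 1 +
      ((r * r) • (((heckeUnit ha * heckeUnit hb)⁻¹ : Rˣ) : R)) * c := by
  have h1 : ((heckeUnit ha * heckeUnit hb : Rˣ) : R) =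
      r • ((d - algebraMap ℂ R δ) * (c - algebraMap ℂ R γ)) := by
    rw [← smul_mul_assoc, ← heckeUnit_mul_mul ha hb hd hprod, mul_assoc, mul_sub_of_mul_self hc,
      mul_one]
  have h2 : c * d = r • (((heckeUnit ha * heckeUnit hb)⁻¹ : Rˣ) : R) := by
    rw [heckeUnit_mul_inv_eq ha hb hr hprod, smul_smul, mul_inv_cancel₀ hr, one_smul]
  rw [h1, mul_smul_comm, ← mul_assoc, mul_sub c, h2, sub_mul, ← Algebra.commutes, mul_assoc _ c,
    mul_sub_of_mul_self hc]
  simp only [Algebra.algebraMap_eq_smul_one, mul_sub, smul_mul_assoc, mul_smul_comm, mul_one]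
  module

/-- The normal forms `∑ xᵢ wᵢ` span a subspace that is stable under left multiplication by the four
generators. -/
theorem mul_mem_normalForms (hc : c * c = γ • c + 1) (hd : d * d = δ • d + 1) (hr : r ≠ 0)
    (hprod : a * b * c * d = algebraMap ℂ R r) {t x : R} (ht : t = a ∨ t = b ∨ t = c ∨ t = d)
    (hx : x ∈ zpowSpan (heckeUnit ha * heckeUnit hb) * altWordSpan b c) :
    t * x ∈ zpowSpan (heckeUnit ha * heckeUnit hb) * altWordSpan b c := by
  set X := heckeUnit ha * heckeUnit hb with hX
  set S := zpowSpan X * altWordSpan b c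
  have hXS {x : R} (hx : x ∈ S) : X * x ∈ S := by
    have : zpowSpan X * S ≤ S := by
      rw [← mul_assoc]
      exact mul_le_mul_left (Submodule.mul_le.2 fun _ h _ h' => mul_mem_zpowSpan h h') _
    exact this (Submodule.mul_mem_mul (val_mem_zpowSpan X) hx)
  have h1 (z : ℂ) : z • (1 : R) ∈ zpowSpan X := Submodule.smul_mem _ _ (one_mem_zpowSpan X)
  have hbS {x : R} (hx : x ∈ S) : b * x ∈ S := by
    refine mul_mem_zpowSpan_mul (fun x hx => exists_mul_eq_add_mul ?_ ?_ hx)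
      (fun w => first_mul_mem_altWordSpan hb) hx
    · exact ⟨_, add_mem (Submodule.smul_mem _ _ (val_mem_zpowSpan X)) (h1 _), _,
        inv_mem_zpowSpan X, mul_heckeUnit_mul ha hb⟩
    · exact ⟨_, sub_mem (Submodule.smul_mem _ _ (val_mem_zpowSpan X)) (h1 _), _,
        val_mem_zpowSpan X, mul_heckeUnit_mul_inv ha hb⟩
  have hcS {x : R} (hx : x ∈ S) : c * x ∈ S := by
    refine mul_mem_zpowSpan_mul (fun x hx => exists_mul_eq_add_mul ?_ ?_ hx)
      (fun w => second_mul_mem_altWordSpan hc) hx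
    · exact ⟨_, sub_mem (Submodule.smul_mem _ _ (inv_mem_zpowSpan X)) (h1 _), _,
        Submodule.smul_mem _ _ (inv_mem_zpowSpan X), mul_heckeUnit_mul' ha hb hc hd hr hprod⟩
    · exact ⟨_, add_mem (Submodule.smul_mem _ _ (inv_mem_zpowSpan X)) (h1 _), _,
        Submodule.smul_mem _ _ (val_mem_zpowSpan X), mul_heckeUnit_mul_inv' ha hb hc hd hr hprod⟩
  rcases ht with rfl | rfl | rfl | rfl
  · have : t = X * (b - algebraMap ℂ R β) := by
      rw [hX, val_heckeUnit_mul, mul_assoc, mul_sub_of_mul_self hb, mul_one]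
    rw [this, mul_assoc, sub_mul, ← Algebra.smul_def]
    exact hXS (sub_mem (hbS hx) (Submodule.smul_mem _ _ hx))
  · exact hbS hx
  · exact hcS hx
  · rw [eq_add_smul_heckeUnit_mul ha hb hd hr hprod, add_mul, smul_mul_assoc, one_mul,
      smul_mul_assoc, mul_assoc]
    exact add_mem (Submodule.smul_mem _ _ hx) (Submodule.smul_mem _ _ (hXS (hcS hx)))

end HeckeRelation

namespace CherednikAlgebra

variable (ħ : ℂ) (k₀ k₁ u₀ u₁ : ℂˣ)

theorem gen_V₁'_mul_self : gen ħ k₀ k₁ u₀ u₁ .V₁' * gen ħ k₀ k₁ u₀ u₁ .V₁' =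
    barParam u₁ • gen ħ k₀ k₁ u₀ u₁ .V₁' + 1 :=
  mul_self_of_hecke <| by
    simpa [gen] using RingQuot.mkAlgHom_rel ℂ
      (s := CherednikRel k₀ k₁ u₀ u₁ (qPow ħ (-1 / 2))) .hecke_V₁'

theorem gen_V₁_mul_self : gen ħ k₀ k₁ u₀ u₁ .V₁ * gen ħ k₀ k₁ u₀ u₁ .V₁ =
    barParam k₁ • gen ħ k₀ k₁ u₀ u₁ .V₁ + 1 :=
  mul_self_of_hecke <| by
    simpa [gen] using RingQuot.mkAlgHom_rel ℂ
      (s := CherednikRel k₀ k₁ u₀ u₁ (qPow ħ (-1 / 2))) .hecke_V₁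

theorem gen_V₀_mul_self : gen ħ k₀ k₁ u₀ u₁ .V₀ * gen ħ k₀ k₁ u₀ u₁ .V₀ =
    barParam k₀ • gen ħ k₀ k₁ u₀ u₁ .V₀ + 1 :=
  mul_self_of_hecke <| by
    simpa [gen] using RingQuot.mkAlgHom_rel ℂ
      (s := CherednikRel k₀ k₁ u₀ u₁ (qPow ħ (-1 / 2))) .hecke_V₀

theorem gen_V₀'_mul_self : gen ħ k₀ k₁ u₀ u₁ .V₀' * gen ħ k₀ k₁ u₀ u₁ .V₀' =
    barParam u₀ • gen ħ k₀ k₁ u₀ u₁ .V₀' + 1 :=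
  mul_self_of_hecke <| by
    simpa [gen] using RingQuot.mkAlgHom_rel ℂ
      (s := CherednikRel k₀ k₁ u₀ u₁ (qPow ħ (-1 / 2))) .hecke_V₀'

theorem gen_prod : gen ħ k₀ k₁ u₀ u₁ .V₁' * gen ħ k₀ k₁ u₀ u₁ .V₁ * gen ħ k₀ k₁ u₀ u₁ .V₀ *
    gen ħ k₀ k₁ u₀ u₁ .V₀' = algebraMap ℂ _ (exp (-(I * Real.pi * ħ) * (-1 / 2))) := by
  have h := RingQuot.mkAlgHom_rel ℂ (s := CherednikRel k₀ k₁ u₀ u₁ (qPow ħ (-1 / 2))) .prod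
  simp only [map_mul, AlgHom.commutes] at h
  exact h

/-- The unit `V̌₁ V₁`. -/
def unitX : (CherednikAlgebra ħ k₀ k₁ u₀ u₁)ˣ :=
  heckeUnit (gen_V₁'_mul_self ħ k₀ k₁ u₀ u₁) * heckeUnit (gen_V₁_mul_self ħ k₀ k₁ u₀ u₁)

theorem gen_mul_mem (g : CherednikGen) {x : CherednikAlgebra ħ k₀ k₁ u₀ u₁}
    (hx : x ∈ zpowSpan (unitX ħ k₀ k₁ u₀ u₁) *
      altWordSpan (gen ħ k₀ k₁ u₀ u₁ .V₁) (gen ħ k₀ k₁ u₀ u₁ .V₀)) :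
    gen ħ k₀ k₁ u₀ u₁ g * x ∈ zpowSpan (unitX ħ k₀ k₁ u₀ u₁) *
      altWordSpan (gen ħ k₀ k₁ u₀ u₁ .V₁) (gen ħ k₀ k₁ u₀ u₁ .V₀) := by
  refine mul_mem_normalForms (gen_V₁'_mul_self ħ k₀ k₁ u₀ u₁) (gen_V₁_mul_self ħ k₀ k₁ u₀ u₁)
    (gen_V₀_mul_self ħ k₀ k₁ u₀ u₁) (gen_V₀'_mul_self ħ k₀ k₁ u₀ u₁) (exp_ne_zero _)
    (gen_prod ħ k₀ k₁ u₀ u₁) ?_ hx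
  cases g <;> simp

/-- Every element of the Cherednik algebra has a normal form. -/
theorem exists_mem_normalForm (x : CherednikAlgebra ħ k₀ k₁ u₀ u₁) :
    ∃ N, x ∈ normalForm (unitX ħ k₀ k₁ u₀ u₁) (gen ħ k₀ k₁ u₀ u₁ .V₁)
      (gen ħ k₀ k₁ u₀ u₁ .V₀) N := by
  set S := zpowSpan (unitX ħ k₀ k₁ u₀ u₁) *
      altWordSpan (gen ħ k₀ k₁ u₀ u₁ .V₁) (gen ħ k₀ k₁ u₀ u₁ .V₀) with hS
  refine _root_.exists_mem_normalForm ?_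
  obtain ⟨w, rfl⟩ := RingQuot.mkAlgHom_surjective ℂ _ x
  have h1 : (1 : CherednikAlgebra ħ k₀ k₁ u₀ u₁) ∈ S := by
    simpa using Submodule.mul_mem_mul (one_mem_zpowSpan (unitX ħ k₀ k₁ u₀ u₁))
      (one_mem_altWordSpan (gen ħ k₀ k₁ u₀ u₁ .V₁) (gen ħ k₀ k₁ u₀ u₁ .V₀))
  suffices h : ∀ y ∈ S, RingQuot.mkAlgHom ℂ _ w * y ∈ S by simpa using h 1 h1
  induction w using FreeAlgebra.induction with
  | grade0 z =>
    intro y hy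
    rw [AlgHom.commutes, ← Algebra.smul_def]
    exact Submodule.smul_mem _ _ hy
  | grade1 g => exact fun y hy => gen_mul_mem ħ k₀ k₁ u₀ u₁ g hy
  | mul v w hv hw => intro y hy; rw [map_mul, mul_assoc]; exact hv _ (hw _ hy)
  | add v w hv hw => intro y hy; rw [map_add, add_mul]; exact add_mem (hv _ hy) (hw _ hy)

end CherednikAlgebra

/-! ### Leading terms of the matrices and injectivity -/

namespace QuantumTorus

variable {ħ : ℂ}

theorem mem_matrixDegreeLE_iff {n : ℤ} {w x y z : QuantumTorus ħ} :
    !![w, x; y, z] ∈ matrixDegreeLE ħ n ↔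
      (w ∈ degreeLE ħ n ∧ x ∈ degreeLE ħ (n + 1)) ∧ y ∈ degreeLE ħ (n - 1) ∧ z ∈ degreeLE ħ n := by
  change (∀ i j : Fin 2, _) ↔ _
  simp [Fin.forall_fin_two, sub_eq_add_neg]

theorem symb_of (n : ℤ) (w x y z : QuantumTorus ħ) :
    symb n !![w, x; y, z] = !![part n w, part (n + 1) x; part (n - 1) y, part n z] := by
  ext i j
  rw [symb_apply]
  fin_cases i <;> fin_cases j <;> simp [sub_eq_add_neg]

theorem smul_e_mem_degreeLE {n a b : ℤ} (z : ℂ) (h : a - b ≤ n) : z • e ħ a b ∈ degreeLE ħ n :=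
  Submodule.smul_mem _ _ (e_mem_degreeLE h)

theorem e_ne_zero (a b : ℤ) : e ħ a b ≠ 0 := mono_ne_zero one_ne_zero

theorem one_mem_matrixDegreeLE : (1 : Matrix (Fin 2) (Fin 2) (QuantumTorus ħ)) ∈
    matrixDegreeLE ħ 0 := by
  rw [Matrix.one_fin_two, mem_matrixDegreeLE_iff, one_eq_e]
  exact ⟨⟨e_mem_degreeLE (by norm_num), zero_mem _⟩, zero_mem _, e_mem_degreeLE (by norm_num)⟩

theorem symb_one : symb 0 (1 : Matrix (Fin 2) (Fin 2) (QuantumTorus ħ)) = 1 := by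
  rw [Matrix.one_fin_two, symb_of, one_eq_e]
  simp [part_e]

theorem algebraMap_mem_matrixDegreeLE (z : ℂ) :
    algebraMap ℂ (Matrix (Fin 2) (Fin 2) (QuantumTorus ħ)) z ∈ matrixDegreeLE ħ 0 := by
  rw [Algebra.algebraMap_eq_smul_one]
  exact Submodule.smul_mem _ _ one_mem_matrixDegreeLE

theorem symb_algebraMap (z : ℂ) :
    symb 0 (algebraMap ℂ (Matrix (Fin 2) (Fin 2) (QuantumTorus ħ)) z) = algebraMap ℂ _ z := by
  rw [Algebra.algebraMap_eq_smul_one, map_smul, symb_one]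

section

variable {n : ℤ} {M N : Matrix (Fin 2) (Fin 2) (QuantumTorus ħ)}

theorem zero_mul_mem_matrixDegreeLE (hM : M ∈ matrixDegreeLE ħ 0) (hN : N ∈ matrixDegreeLE ħ n) :
    M * N ∈ matrixDegreeLE ħ n := by
  simpa only [zero_add] using mul_mem_matrixDegreeLE hM hN

theorem mul_zero_mem_matrixDegreeLE (hM : M ∈ matrixDegreeLE ħ n) (hN : N ∈ matrixDegreeLE ħ 0) :
    M * N ∈ matrixDegreeLE ħ n := by
  simpa only [add_zero] using mul_mem_matrixDegreeLE hM hN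

theorem symb_zero_mul (hM : M ∈ matrixDegreeLE ħ 0) (hN : N ∈ matrixDegreeLE ħ n) :
    symb n (M * N) = symb 0 M * symb n N := by
  simpa only [zero_add] using symb_mul hM hN

theorem symb_mul_zero (hM : M ∈ matrixDegreeLE ħ n) (hN : N ∈ matrixDegreeLE ħ 0) :
    symb n (M * N) = symb n M * symb 0 N := by
  simpa only [add_zero] using symb_mul hM hN

end

/-- The matrix `M` has degree at most `0`, and its part of degree `0` is lower triangular with
diagonal entries nonzero multiples of `e^{j(S₁ + S₂)}` and `e^{-j(S₁ + S₂)}`. -/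
def HasTriangularSymb (j : ℤ) (M : Matrix (Fin 2) (Fin 2) (QuantumTorus ħ)) : Prop :=
  M ∈ matrixDegreeLE ħ 0 ∧ symb 0 M 0 1 = 0 ∧
    (∃ z : ℂ, z ≠ 0 ∧ symb 0 M 0 0 = mono ħ (j, j) z) ∧
    ∃ z : ℂ, z ≠ 0 ∧ symb 0 M 1 1 = mono ħ (-j, -j) z

theorem HasTriangularSymb.one : HasTriangularSymb (ħ := ħ) 0 1 :=
  ⟨one_mem_matrixDegreeLE, by rw [symb_one, Matrix.one_apply_ne zero_ne_one],
    ⟨1, one_ne_zero, by rw [symb_one, Matrix.one_apply_eq]; rfl⟩, 1, one_ne_zero, by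
      rw [symb_one, Matrix.one_apply_eq]; rfl⟩

theorem HasTriangularSymb.mul {j l : ℤ} {M N : Matrix (Fin 2) (Fin 2) (QuantumTorus ħ)}
    (hM : HasTriangularSymb j M) (hN : HasTriangularSymb l N) :
    HasTriangularSymb (j + l) (M * N) := by
  obtain ⟨hM, hM0, ⟨z, hz, hMz⟩, w, hw, hMw⟩ := hM
  obtain ⟨hN, hN0, ⟨z', hz', hNz⟩, w', hw', hNw⟩ := hN
  have h : symb 0 (M * N) = symb 0 M * symb 0 N := symb_zero_mul hM hN
  refine ⟨zero_mul_mem_matrixDegreeLE hM hN, ?_,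
    ⟨z * z' * cocycle ħ (j, j) (l, l), mul_ne_zero (mul_ne_zero hz hz') (cocycle_ne_zero _ _), ?_⟩,
    w * w' * cocycle ħ (-j, -j) (-l, -l), mul_ne_zero (mul_ne_zero hw hw') (cocycle_ne_zero _ _),
    ?_⟩
  · rw [h, Matrix.mul_apply, Fin.sum_univ_two, hM0, hN0, mul_zero, zero_mul, add_zero]
  · rw [h, Matrix.mul_apply, Fin.sum_univ_two, hM0, zero_mul, add_zero, hMz, hNz, mono_mul_mono,
      Prod.mk_add_mk]
  · rw [h, Matrix.mul_apply, Fin.sum_univ_two, hN0, mul_zero, zero_add, hMw, hNw, mono_mul_mono,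
      neg_add, Prod.mk_add_mk]

/-- Distinct powers have distinct monomials on the diagonal of the symbol, so that each diagonal
entry detects every element of `ℂ[X, X⁻¹]`. -/
theorem eq_zero_of_hasTriangularSymb {H : Type*} [Ring H] [Algebra ℂ H]
    (φ : H →ₐ[ℂ] Matrix (Fin 2) (Fin 2) (QuantumTorus ħ)) {X : Hˣ}
    (hX : ∀ j : ℤ, HasTriangularSymb j (φ (X ^ j : Hˣ))) {x : H} (hx : x ∈ zpowSpan X) :
    φ x ∈ matrixDegreeLE ħ 0 ∧ symb 0 (φ x) 0 1 = 0 ∧ (symb 0 (φ x) 0 0 = 0 → x = 0) ∧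
      (symb 0 (φ x) 1 1 = 0 → x = 0) := by
  obtain ⟨f, rfl⟩ := Finsupp.mem_span_range_iff_exists_finsupp.1 hx
  have hsymb (i k : Fin 2) : symb 0 (φ (f.sum fun j z => z • ((X ^ j : Hˣ) : H))) i k =
      f.sum fun j z => z • symb 0 (φ (X ^ j : Hˣ)) i k := by
    simp only [Finsupp.sum, map_sum, map_smul, Matrix.sum_apply, Matrix.smul_apply]
  -- A diagonal entry is `∑ fⱼ zⱼ e^{ε j (S₁ + S₂)}` with `ε = ±1` and all `zⱼ` nonzero.
  have key (i : Fin 2) (ε : ℤ) (hε : ε ≠ 0)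
      (h : ∀ j : ℤ, ∃ z : ℂ, z ≠ 0 ∧ symb 0 (φ (X ^ j : Hˣ)) i i = mono ħ (ε * j, ε * j) z)
      (h0 : symb 0 (φ (f.sum fun j z => z • ((X ^ j : Hˣ) : H))) i i = 0) : f = 0 := by
    choose z hz hzX using h
    rw [hsymb] at h0
    ext l
    have h1 := congrArg (coeff (ε * l, ε * l)) h0
    simp only [hzX, Finsupp.sum, map_sum, map_smul, map_zero, coeff_mono, Prod.mk.injEq, and_self,
      mul_right_inj' hε, smul_eq_mul, mul_ite, mul_zero, Finset.sum_ite_eq', ite_eq_right_iff,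
      mul_eq_zero, hz, or_false, Finsupp.mem_support_iff] at h1
    by_contra hl
    exact hl (h1 hl)
  refine ⟨?_, ?_, fun h => ?_, fun h => ?_⟩
  · rw [Finsupp.sum, map_sum]
    refine Submodule.sum_mem _ fun j _ => ?_
    rw [map_smul]
    exact Submodule.smul_mem _ _ (hX j).1
  · rw [hsymb]
    exact Finset.sum_eq_zero fun j _ => by simp only [(hX j).2.1, smul_zero]
  · rw [key 0 1 one_ne_zero (fun j => by simpa using (hX j).2.2.1) h, Finsupp.sum_zero_index]
  · rw [key 1 (-1) (by norm_num) (fun j => by simpa using (hX j).2.2.2) h,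
      Finsupp.sum_zero_index]

end QuantumTorus

section

variable (ħ : ℂ) (k₀ k₁ u₀ u₁ : ℂˣ)

theorem repMatrix_V₁'_mem : repMatrix ħ k₀ k₁ u₀ u₁ .V₁' ∈ matrixDegreeLE ħ 0 := by
  rw [repMatrix_V₁', mem_matrixDegreeLE_iff]
  exact ⟨⟨zero_mem _, smul_e_mem_degreeLE _ (by norm_num)⟩, smul_e_mem_degreeLE _ (by norm_num),
    smul_e_mem_degreeLE _ (by norm_num)⟩

theorem symb_repMatrix_V₁' :
    symb 0 (repMatrix ħ k₀ k₁ u₀ u₁ .V₁') = repMatrix ħ k₀ k₁ u₀ u₁ .V₁' := by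
  rw [repMatrix_V₁', symb_of]
  simp [part_e]

theorem repMatrix_V₁_mem : repMatrix ħ k₀ k₁ u₀ u₁ .V₁ ∈ matrixDegreeLE ħ 0 := by
  rw [repMatrix_V₁, mem_matrixDegreeLE_iff]
  refine ⟨⟨sub_mem ?_ ?_, sub_mem (sub_mem ?_ ?_) ?_⟩, ?_, ?_⟩ <;>
  exact smul_e_mem_degreeLE _ (by norm_num)

theorem symb_repMatrix_V₁ : symb 0 (repMatrix ħ k₀ k₁ u₀ u₁ .V₁) =
    !![barParam k₁ • e ħ 0 0, -I • e ħ 0 (-1); I • e ħ 0 1, 0] := by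
  rw [repMatrix_V₁, symb_of]
  simp [part_e]

theorem repMatrix_V₀_mem : repMatrix ħ k₀ k₁ u₀ u₁ .V₀ ∈ matrixDegreeLE ħ 1 := by
  rw [repMatrix_V₀, mem_matrixDegreeLE_iff]
  refine ⟨⟨add_mem ?_ ?_, ?_⟩, add_mem (sub_mem ?_ ?_) ?_, ?_⟩ <;>
  exact smul_e_mem_degreeLE _ (by norm_num)

/-- The part of degree `1` of the matrix of `V₀` is a nonzero multiple of `E₂₁`. -/
theorem exists_symb_repMatrix_V₀ :
    ∃ p, p ≠ 0 ∧ symb 1 (repMatrix ħ k₀ k₁ u₀ u₁ .V₀) = !![0, 0; p, 0] := by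
  refine ⟨-barParam k₀ • e ħ 0 0 - (u₀ : ℂ) • e ħ 1 1 + (u₀ : ℂ)⁻¹ • e ħ (-1) (-1),
    fun h => ?_, ?_⟩
  · have := congrArg (coeff (1, 1)) h
    simp [e, coeff_mono] at this
  · rw [repMatrix_V₀, symb_of]
    simp [part_e]

theorem hasTriangularSymb_mul :
    HasTriangularSymb 1 (repMatrix ħ k₀ k₁ u₀ u₁ .V₁' * repMatrix ħ k₀ k₁ u₀ u₁ .V₁) := by
  have h : _ := symb_zero_mul (repMatrix_V₁'_mem ħ k₀ k₁ u₀ u₁)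
    (repMatrix_V₁_mem ħ k₀ k₁ u₀ u₁)
  rw [symb_repMatrix_V₁', symb_repMatrix_V₁, repMatrix_V₁'] at h
  refine ⟨zero_mul_mem_matrixDegreeLE (repMatrix_V₁'_mem ħ k₀ k₁ u₀ u₁)
    (repMatrix_V₁_mem ħ k₀ k₁ u₀ u₁), ?_, ⟨cocycle ħ (1, 0) (0, 1), cocycle_ne_zero _ _, ?_⟩,
    ⟨cocycle ħ (-1, 0) (0, -1), cocycle_ne_zero _ _, ?_⟩⟩ <;> rw [repMatrix_V₁'] <;> rw [h]
  · simp
  · simp [smul_smul, e, mono_mul_mono]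
  · simp [smul_smul, e, mono_mul_mono]

theorem hasTriangularSymb_inv_mul :
    HasTriangularSymb (-1) ((repMatrix ħ k₀ k₁ u₀ u₁ .V₁ - algebraMap ℂ _ (barParam k₁)) *
      (repMatrix ħ k₀ k₁ u₀ u₁ .V₁' - algebraMap ℂ _ (barParam u₁))) := by
  have hB := sub_mem (repMatrix_V₁_mem ħ k₀ k₁ u₀ u₁)
    (algebraMap_mem_matrixDegreeLE (ħ := ħ) (barParam k₁))
  have hA := sub_mem (repMatrix_V₁'_mem ħ k₀ k₁ u₀ u₁)
    (algebraMap_mem_matrixDegreeLE (ħ := ħ) (barParam u₁))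
  have h : _ := symb_zero_mul hB hA
  have h' := zero_mul_mem_matrixDegreeLE hB hA
  rw [map_sub, map_sub, symb_algebraMap, symb_algebraMap, symb_repMatrix_V₁', symb_repMatrix_V₁,
    algebraMap_matrix, algebraMap_matrix] at h
  rw [algebraMap_matrix, algebraMap_matrix] at h' ⊢
  refine ⟨h', ?_, ⟨cocycle ħ (0, -1) (-1, 0), cocycle_ne_zero _ _, ?_⟩,
    ⟨cocycle ħ (0, 1) (1, 0), cocycle_ne_zero _ _, ?_⟩⟩ <;> rw [h] <;> rw [repMatrix_V₁']
  · simp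
  · simp [smul_smul, e, mono_mul_mono]
  · simp [smul_smul, e, mono_mul_mono]

/-- The top homogeneous part of `(V₁ V₀)ⁿ` is a nonzero multiple of `E₁₁`, up to the entry `(2, 2)`
(which is nonzero for `n = 0`). -/
theorem exists_symb_pow (n : ℕ) :
    (repMatrix ħ k₀ k₁ u₀ u₁ .V₁ * repMatrix ħ k₀ k₁ u₀ u₁ .V₀) ^ n ∈ matrixDegreeLE ħ n ∧
    ∃ g w, g ≠ 0 ∧ symb n ((repMatrix ħ k₀ k₁ u₀ u₁ .V₁ * repMatrix ħ k₀ k₁ u₀ u₁ .V₀) ^ n) =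
      !![g, 0; 0, w] := by
  induction n with
  | zero =>
    refine ⟨one_mem_matrixDegreeLE, 1, 1, e_ne_zero 0 0, ?_⟩
    rw [pow_zero, Nat.cast_zero, symb_one, Matrix.one_fin_two]
  | succ n ih =>
    obtain ⟨hn, g, w, hg, hgw⟩ := ih
    obtain ⟨p, hp, hC⟩ := exists_symb_repMatrix_V₀ ħ k₀ k₁ u₀ u₁
    have hBC := zero_mul_mem_matrixDegreeLE (repMatrix_V₁_mem ħ k₀ k₁ u₀ u₁)
      (repMatrix_V₀_mem ħ k₀ k₁ u₀ u₁)
    have hs := symb_zero_mul (repMatrix_V₁_mem ħ k₀ k₁ u₀ u₁) (repMatrix_V₀_mem ħ k₀ k₁ u₀ u₁)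
    rw [pow_succ, Nat.cast_succ]
    refine ⟨mul_mem_matrixDegreeLE hn hBC, g * (-I • e ħ 0 (-1) * p), 0,
      mul_ne_zero hg (mul_ne_zero (smul_ne_zero (neg_ne_zero.2 I_ne_zero) (e_ne_zero _ _)) hp), ?_⟩
    rw [symb_mul hn hBC, hs, hgw, hC, symb_repMatrix_V₁]
    simp

end

namespace CherednikAlgebra

variable {ħ : ℂ} {k₀ k₁ u₀ u₁ : ℂˣ}
  (φ : CherednikAlgebra ħ k₀ k₁ u₀ u₁ →ₐ[ℂ] Matrix (Fin 2) (Fin 2) (QuantumTorus ħ))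

/-- The image of `X^j` has a lower triangular leading part. -/
theorem hasTriangularSymb_zpow (hφ : ∀ g, φ (gen ħ k₀ k₁ u₀ u₁ g) = repMatrix ħ k₀ k₁ u₀ u₁ g)
    (j : ℤ) :
    HasTriangularSymb j (φ (unitX ħ k₀ k₁ u₀ u₁ ^ j : (CherednikAlgebra ħ k₀ k₁ u₀ u₁)ˣ)) := by
  induction j using Int.induction_on with
  | zero => rw [zpow_zero, Units.val_one, map_one]; exact .one
  | succ i ih =>
    rw [zpow_add_one, Units.val_mul, map_mul]
    refine ih.mul ?_
    rw [unitX, val_heckeUnit_mul, map_mul, hφ, hφ]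
    exact hasTriangularSymb_mul ħ k₀ k₁ u₀ u₁
  | pred i ih =>
    rw [zpow_sub_one, Units.val_mul, map_mul]
    refine ih.mul ?_
    rw [unitX, val_heckeUnit_mul_inv, map_mul, map_sub, map_sub, hφ, hφ, AlgHom.commutes,
      AlgHom.commutes]
    exact hasTriangularSymb_inv_mul ħ k₀ k₁ u₀ u₁


/-- A normal form with at most `N` letters `c` has degree at most `N`, and it vanishes if its image
does, since its coefficients can be read off from the leading part of the image. -/
theorem eq_zero_of_mem_normalForm
    (hφ : ∀ g, φ (gen ħ k₀ k₁ u₀ u₁ g) = repMatrix ħ k₀ k₁ u₀ u₁ g) (N : ℕ)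
    {h : CherednikAlgebra ħ k₀ k₁ u₀ u₁} (hh : h ∈ normalForm (unitX ħ k₀ k₁ u₀ u₁)
      (gen ħ k₀ k₁ u₀ u₁ .V₁) (gen ħ k₀ k₁ u₀ u₁ .V₀) N) :
    φ h ∈ matrixDegreeLE ħ N ∧ (φ h = 0 → h = 0) := by
  have hB := repMatrix_V₁_mem ħ k₀ k₁ u₀ u₁
  have hC := repMatrix_V₀_mem ħ k₀ k₁ u₀ u₁
  have hsB := symb_repMatrix_V₁ ħ k₀ k₁ u₀ u₁
  obtain ⟨p, hp, hsC⟩ := exists_symb_repMatrix_V₀ ħ k₀ k₁ u₀ u₁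
  have hX {x} (hx : x ∈ zpowSpan (unitX ħ k₀ k₁ u₀ u₁)) :=
    eq_zero_of_hasTriangularSymb φ (hasTriangularSymb_zpow φ hφ) hx
  have hI : (-I • e ħ 0 (-1)) ≠ 0 := smul_ne_zero (neg_ne_zero.2 I_ne_zero) (e_ne_zero _ _)
  induction N generalizing h with
  | zero =>
    obtain ⟨x, hx, _, ⟨y, hy, rfl⟩, rfl⟩ := Submodule.mem_sup.1 hh
    obtain ⟨hxm, hx0, hx1, -⟩ := hX hx
    obtain ⟨hym, hy0, hy1, -⟩ := hX hy
    have hyB := zero_mul_mem_matrixDegreeLE hym hB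
    simp only [LinearMap.mulRight_apply, map_add, map_mul, hφ, Nat.cast_zero]
    refine ⟨add_mem hxm hyB, fun h0 => ?_⟩
    have h1 := congrArg (symb 0) h0
    rw [map_add, symb_zero_mul hym hB, hsB, map_zero] at h1
    have h01 := congrFun (congrFun h1 0) 1
    have h00 := congrFun (congrFun h1 0) 0
    simp only [Matrix.add_apply, Matrix.mul_apply, Fin.sum_univ_two, hx0, hy0] at h01 h00
    have hy' : y = 0 := hy1 (by simpa [hI, e_ne_zero] using h01)
    subst hy'
    have hx' : x = 0 := hx1 (by simpa using h00)
    simp [hx']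
  | succ n ih =>
    obtain ⟨y, hy, z, hz, rfl⟩ := Submodule.mem_sup.1 hh
    obtain ⟨k, hk, v, hv, rfl⟩ := Submodule.mem_sup.1 hy
    obtain ⟨_, ⟨x₁, hx₁, rfl⟩, _, ⟨x₂, hx₂, rfl⟩, rfl⟩ := Submodule.mem_sup.1 hv
    obtain ⟨_, ⟨x₃, hx₃, rfl⟩, _, ⟨x₄, hx₄, rfl⟩, rfl⟩ := Submodule.mem_sup.1 hz
    obtain ⟨hm₁, hu₁, h₁, -⟩ := hX hx₁
    obtain ⟨hm₂, hu₂, h₂, -⟩ := hX hx₂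
    obtain ⟨hm₃, hu₃, -, h₃⟩ := hX hx₃
    obtain ⟨hm₄, hu₄, -, h₄⟩ := hX hx₄
    obtain ⟨hP, g, w, hg, hsP⟩ := exists_symb_pow ħ k₀ k₁ u₀ u₁ (n + 1)
    obtain ⟨hQ, g', w', hg', hsQ⟩ := exists_symb_pow ħ k₀ k₁ u₀ u₁ n
    have hkm : φ k ∈ matrixDegreeLE ħ (n + 1 : ℕ) :=
      matrixDegreeLE_mono (by push_cast; omega) (ih hk).1
    have hk0 : symb (n + 1 : ℕ) (φ k) = 0 := symb_eq_zero (by push_cast; omega) (ih hk).1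
    have hPB := mul_zero_mem_matrixDegreeLE hP hB
    have hCQ : repMatrix ħ k₀ k₁ u₀ u₁ .V₀ *
        (repMatrix ħ k₀ k₁ u₀ u₁ .V₁ * repMatrix ħ k₀ k₁ u₀ u₁ .V₀) ^ n ∈
        matrixDegreeLE ħ (n + 1 : ℕ) := by
      rw [Nat.cast_succ, add_comm]
      exact mul_mem_matrixDegreeLE hC hQ
    have hsCQ : symb (n + 1 : ℕ) (repMatrix ħ k₀ k₁ u₀ u₁ .V₀ *
        (repMatrix ħ k₀ k₁ u₀ u₁ .V₁ * repMatrix ħ k₀ k₁ u₀ u₁ .V₀) ^ n) = !![0, 0; p * g', 0] := by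
      rw [Nat.cast_succ, add_comm, symb_mul hC hQ, hsC, hsQ, Matrix.mul_fin_two]
      simp only [zero_mul, mul_zero, add_zero]
    have hCQB := mul_zero_mem_matrixDegreeLE hCQ hB
    have hsPB := symb_mul_zero hP hB
    have hsCQB := symb_mul_zero hCQ hB
    rw [hsP, hsB] at hsPB
    rw [hsCQ, hsB] at hsCQB
    simp only [LinearMap.mulRight_apply, map_add, map_mul, map_pow, hφ]
    refine ⟨add_mem (add_mem hkm (add_mem (zero_mul_mem_matrixDegreeLE hm₁ hP)
      (zero_mul_mem_matrixDegreeLE hm₂ hPB))) (add_mem (zero_mul_mem_matrixDegreeLE hm₃ hCQ)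
      (zero_mul_mem_matrixDegreeLE hm₄ hCQB)), fun h0 => ?_⟩
    have hs := congrArg (symb (n + 1 : ℕ)) h0
    rw [map_add, map_add, map_add, map_add, map_zero, hk0, zero_add, symb_zero_mul hm₁ hP,
      symb_zero_mul hm₂ hPB, symb_zero_mul hm₃ hCQ, symb_zero_mul hm₄ hCQB, hsP, hsPB, hsCQ,
      hsCQB] at hs
    -- The first row of the symbol only involves `x₁` and `x₂`.
    have h01 := congrFun (congrFun hs 0) 1
    have h00 := congrFun (congrFun hs 0) 0
    simp [Matrix.mul_apply, Fin.sum_univ_two, hu₁, hu₂, hu₃, hu₄] at h01 h00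
    have e₂ : x₂ = 0 := h₂ (by simpa [hg, e_ne_zero] using h01)
    subst e₂
    have e₁ : x₁ = 0 := h₁ (by simpa [hg] using h00)
    subst e₁
    -- In the second row, only the diagonal entries of `x₃` and `x₄` meet nonzero entries.
    have h11 := congrFun (congrFun hs 1) 1
    have h10 := congrFun (congrFun hs 1) 0
    simp [Matrix.mul_apply, Fin.sum_univ_two] at h11 h10
    have e₄ : x₄ = 0 := h₄ (by simpa [hp, hg', e_ne_zero] using h11)
    subst e₄
    have e₃ : x₃ = 0 := h₃ (by simpa [hp, hg'] using h10)
    subst e₃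
    simp only [map_zero, zero_mul, add_zero] at h0 ⊢
    exact (ih hk).2 h0

theorem injective_of_gen_eq_repMatrix
    (hφ : ∀ g, φ (gen ħ k₀ k₁ u₀ u₁ g) = repMatrix ħ k₀ k₁ u₀ u₁ g) : Function.Injective φ := by
  refine (injective_iff_map_eq_zero φ).2 fun h h0 => ?_
  obtain ⟨N, hN⟩ := exists_mem_normalForm ħ k₀ k₁ u₀ u₁ h
  exact (eq_zero_of_mem_normalForm φ hφ N hN).2 h0

end CherednikAlgebra

theorem repMatrix_prod (ħ : ℂ) (k₀ k₁ u₀ u₁ : ℂˣ) :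
    repMatrix ħ k₀ k₁ u₀ u₁ .V₁' * repMatrix ħ k₀ k₁ u₀ u₁ .V₁ * repMatrix ħ k₀ k₁ u₀ u₁ .V₀ *
      repMatrix ħ k₀ k₁ u₀ u₁ .V₀' = algebraMap ℂ _ (exp (-(I * Real.pi * ħ) * (-1 / 2))) := by
  have hA := mul_sub_of_mul_self (mul_self_of_hecke (hecke_repMatrix_V₁' ħ k₀ k₁ u₀ u₁))
  have hB := mul_sub_of_mul_self (mul_self_of_hecke (hecke_repMatrix_V₁ ħ k₀ k₁ u₀ u₁))
  rw [mul_assoc, repMatrix_V₀_mul_V₀', Algebra.left_comm, mul_assoc (repMatrix ħ k₀ k₁ u₀ u₁ .V₁'),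
    ← mul_assoc _ (_ - _), hB, one_mul, hA, mul_one]

/-- The representation of the Cherednik algebra by `2 × 2` matrices over the quantum torus. -/
def CherednikAlgebra.rep (ħ : ℂ) (k₀ k₁ u₀ u₁ : ℂˣ) :
    CherednikAlgebra ħ k₀ k₁ u₀ u₁ →ₐ[ℂ] Matrix (Fin 2) (Fin 2) (QuantumTorus ħ) :=
  RingQuot.liftAlgHom ℂ ⟨FreeAlgebra.lift ℂ (repMatrix ħ k₀ k₁ u₀ u₁), fun x y h => by
    cases h <;>
      simp only [map_mul, map_add, map_sub, map_zero, AlgHom.commutes, FreeAlgebra.lift_ι_apply]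
    · exact hecke_repMatrix_V₀ ħ k₀ k₁ u₀ u₁
    · exact hecke_repMatrix_V₁ ħ k₀ k₁ u₀ u₁
    · exact hecke_repMatrix_V₀' ħ k₀ k₁ u₀ u₁
    · exact hecke_repMatrix_V₁' ħ k₀ k₁ u₀ u₁
    · exact repMatrix_prod ħ k₀ k₁ u₀ u₁⟩

theorem CherednikAlgebra.rep_gen (ħ : ℂ) (k₀ k₁ u₀ u₁ : ℂˣ) (g : CherednikGen) :
    rep ħ k₀ k₁ u₀ u₁ (gen ħ k₀ k₁ u₀ u₁ g) = repMatrix ħ k₀ k₁ u₀ u₁ g := by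
  rw [rep, gen, RingQuot.liftAlgHom_mkAlgHom_apply, FreeAlgebra.lift_ι_apply]

end

theorem theorem1 (ħ : ℂ) (hq : ∀ m : ℕ, 0 < m → Complex.exp (-(Complex.I * Real.pi * ħ)) ^ m ≠ 1)
    (k₀ k₁ u₀ u₁ : ℂˣ) :
    let V₀ := repMatrix ħ k₀ k₁ u₀ u₁ .V₀
    let V₁ := repMatrix ħ k₀ k₁ u₀ u₁ .V₁
    let V₁' := repMatrix ħ k₀ k₁ u₀ u₁ .V₁'
    let V₀' := repMatrix ħ k₀ k₁ u₀ u₁ .V₀'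
    let c := algebraMap ℂ (Matrix (Fin 2) (Fin 2) (QuantumTorus ħ))
    (∃ φ : CherednikAlgebra ħ k₀ k₁ u₀ u₁ →ₐ[ℂ] Matrix (Fin 2) (Fin 2) (QuantumTorus ħ),
      (∀ g : CherednikGen,
        φ (CherednikAlgebra.gen ħ k₀ k₁ u₀ u₁ g) = repMatrix ħ k₀ k₁ u₀ u₁ g) ∧
      Function.Injective φ) ∧
    (∀ g : CherednikGen, IsUnit (repMatrix ħ k₀ k₁ u₀ u₁ g)) ∧
    (V₀ - c k₀) * (V₀ + c (k₀ : ℂ)⁻¹) = 0 ∧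
    (V₁ - c k₁) * (V₁ + c (k₁ : ℂ)⁻¹) = 0 ∧
    (V₀' - c u₀) * (V₀' + c (u₀ : ℂ)⁻¹) = 0 ∧
    (V₁' - c u₁) * (V₁' + c (u₁ : ℂ)⁻¹) = 0 ∧
    V₁' * V₁ * V₀ * V₀' = c (Complex.exp (-(Complex.I * Real.pi * ħ) * (-1 / 2))) := by
  intro V₀ V₁ V₁' V₀' c
  refine ⟨⟨CherednikAlgebra.rep ħ k₀ k₁ u₀ u₁, CherednikAlgebra.rep_gen ħ k₀ k₁ u₀ u₁,
    CherednikAlgebra.injective_of_gen_eq_repMatrix _ (CherednikAlgebra.rep_gen ħ k₀ k₁ u₀ u₁)⟩,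
    fun g => ?_, hecke_repMatrix_V₀ ħ k₀ k₁ u₀ u₁, hecke_repMatrix_V₁ ħ k₀ k₁ u₀ u₁,
    hecke_repMatrix_V₀' ħ k₀ k₁ u₀ u₁, hecke_repMatrix_V₁' ħ k₀ k₁ u₀ u₁,
    repMatrix_prod ħ k₀ k₁ u₀ u₁⟩
  cases g
  · exact (heckeUnit (mul_self_of_hecke (hecke_repMatrix_V₀ ħ k₀ k₁ u₀ u₁))).isUnit
  · exact (heckeUnit (mul_self_of_hecke (hecke_repMatrix_V₁ ħ k₀ k₁ u₀ u₁))).isUnit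
  · exact (heckeUnit (mul_self_of_hecke (hecke_repMatrix_V₁' ħ k₀ k₁ u₀ u₁))).isUnit
  · exact (heckeUnit (mul_self_of_hecke (hecke_repMatrix_V₀' ħ k₀ k₁ u₀ u₁))).isUnit
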